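/- Let $K$ be a field, $n\ge 1$, and let $E=K\langle e_1,\dots,e_n\rangle$ be the exterior algebra of a $K$-vector space with basis $e_1,\dots,e_n$. For $\mu=\{i_1<\dots<i_\ell\}\subseteq\{1,\dots,n\}$ write $e_\mu=e_{i_1}\wedge\cdots\wedge e_{i_\ell}$, a monomial of degree $\ell$, and, for $\mu\neq\emptyset$, $\mathrm m(e_\mu)=\max\mu$. Let $d\ge 2$ and let ${\bf t}=(t_1,\dots,t_{d-1})$ be a sequence of non-negative integers. A monomial $e_\mu\ne 1$ as above is called ${\bf t}$-spread if $\ell\le d$ and $i_{h+1}-i_h\ge t_h$ for all $h=1,\dots,\ell-1$. An ideal $I$ of $E$ is called ${\bf t}$-spread strongly stable if it is generated by ${\bf t}$-spread monomials and if, for every ${\bf t}$-spread monomial $e_\mu\in I$, every $j\in\mu$ and every $i<j$ such that $e_ie_{\mu\setminus\{j\}}$ is (up to sign) a ${\bf t}$-spread monomial, one has $e_ie_{\mu\setminus\{j\}}\in I$. Let $G(I)$ be the minimal set of monomial generators of $I$ and $G(I)_j$ the set of its elements of degree $j$. Let $I$ be a ${\bf t}$-spread strongly stable ideal of $E$. Then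 $I$ has a minimal graded free resolution $\cdots\to F_1\to F_0\to I\to 0$ over $E$ by free modules of finite rank, and in every such resolution the number $\beta_{i,i+j}(I)$ of direct summands $E(-(i+j))$ of $F_i$ is, for all integers $i,j\ge 0$, \[ \beta_{i,i+j}(I)=\sum_{u\in G(I)_j}\binom{\mathrm m(u)-\sum_{h=1}^{j-1}\max\{t_h-1,0\}+i-1}{i}. \] In particular, if $t_h\ge 1$ for all $h$, then \[ \beta_{i,i+j}(I)=\sum_{u\in G(I)_j}\binom{\mathrm m(u)-\sum_{h=1}^{j-1}(t_h-1)+i-1}{i}. \] -/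

import Mathlib

open scoped BigOperators

noncomputable section

namespace VectorSpread

/-- The exterior algebra `E = K⟨e_1, …, e_n⟩` of the `K`-vector space `Kⁿ`. -/
abbrev Ext (K : Type*) [Field K] (n : ℕ) : Type _ := ExteriorAlgebra K (Fin n → K)

/-- The generators of `E`. `i : Fin n` stands for the index `i + 1 ∈ {1, …, n}`. -/
def e (K : Type*) [Field K] {n : ℕ} (i : Fin n) : Ext K n :=
  ExteriorAlgebra.ι K (Pi.single i (1 : K))

/-- The monomial `e_μ = e_{i_1} ∧ ⋯ ∧ e_{i_d}` for `μ = {i_1 < ⋯ < i_d}`; `e_∅ = 1`. -/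
def monomial (K : Type*) [Field K] {n : ℕ} (μ : Finset (Fin n)) : Ext K n :=
  ((μ.sort (· ≤ ·)).map (e K)).prod

/-- `m(e_μ) = max μ` in the numbering `1, …, n`, with `m(1) = 0`. -/
def maxSupp {n : ℕ} (μ : Finset (Fin n)) : ℕ := μ.sup fun i => (i : ℕ) + 1

/-- For `t = (t_1, …, t_{d-1})` (`t_{h+1}` is `t h` for `h : Fin (d - 1)`), the monomial `e_μ ≠ 1` with
`μ = {i_1 < ⋯ < i_ℓ}` is `t`-spread if `ℓ ≤ d` and `i_{h+1} - i_h ≥ t_h` for `1 ≤ h ≤ ℓ - 1`. -/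
def IsSpread {d n : ℕ} (t : Fin (d - 1) → ℕ) (μ : Finset (Fin n)) : Prop :=
  μ.Nonempty ∧ μ.card ≤ d ∧
    ∀ (h : Fin (d - 1)) (hh : (h : ℕ) + 1 < μ.card),
      (μ.orderEmbOfFin rfl ⟨(h : ℕ), Nat.lt_of_succ_lt hh⟩ : ℕ) + t h ≤
        (μ.orderEmbOfFin rfl ⟨(h : ℕ) + 1, hh⟩ : ℕ)

/-- A `t`-spread ideal: a monomial ideal generated by `t`-spread monomials. (Left ideals generated
by monomials are two-sided.) -/
def IsSpreadIdeal {K : Type*} [Field K] {d n : ℕ} (t : Fin (d - 1) → ℕ)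
    (I : Ideal (Ext K n)) : Prop :=
  ∃ S : Set (Finset (Fin n)), (∀ μ ∈ S, IsSpread t μ) ∧ I = Ideal.span (monomial K '' S)

/-- A `t`-spread strongly stable ideal. The product `e_i e_{μ ∖ {j}}` with `i < j` is, up to sign,
the monomial of `(μ ∖ {j}) ∪ {i}` if `i ∉ μ`, and it is `0` (so not a monomial) if `i ∈ μ`. -/
def IsSpreadStronglyStable {K : Type*} [Field K] {d n : ℕ} (t : Fin (d - 1) → ℕ)
    (I : Ideal (Ext K n)) : Prop :=
  IsSpreadIdeal t I ∧
    ∀ μ : Finset (Fin n), IsSpread t μ → monomial K μ ∈ I →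
      ∀ j ∈ μ, ∀ i < j, i ∉ μ → IsSpread t (insert i (μ.erase j)) →
        e K i * monomial K (μ.erase j) ∈ I

open scoped Classical in
/-- (The supports of) the set `G(I)_j` of the elements of degree `j` of the minimal set `G(I)` of
monomial generators of `I`, i.e. of the monomials in `I` no proper divisor of which lies in `I`. -/
def minGens {K : Type*} [Field K] {n : ℕ} (I : Ideal (Ext K n)) (j : ℕ) :
    Finset (Finset (Fin n)) :=
  Finset.univ.filter fun μ =>
    (monomial K μ ∈ I ∧ ∀ ν : Finset (Fin n), ν ⊂ μ → monomial K ν ∉ I) ∧ μ.card = j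

/-- The homogeneous elements of degree `k` of the graded free module `⨁_{b ∈ B} E(-deg b)`:
the coefficient at `b` lies in `E_{k - deg b}`, where `E_p = ⋀^p V` for `p ≥ 0` and `E_p = 0`
for `p < 0`. -/
def IsHomog {K : Type*} [Field K] {n : ℕ} {B : Type} (deg : B → ℤ) (k : ℤ)
    (x : B →₀ Ext K n) : Prop :=
  ∀ b, x b ≠ 0 → ∃ p : ℕ, deg b + p = k ∧ x b ∈ ⋀[K]^p (Fin n → K)

/-- A minimal graded free resolution `⋯ → F_2 → F_1 → F_0 → I → 0` over `E` of the ideal `I`, where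
`F_i = ⨁_{b ∈ B i} E(-deg i b)` has finite rank, and all maps are `E`-linear and homogeneous of
degree `0`. -/
structure MinGradedFreeRes {K : Type*} [Field K] {n : ℕ} (I : Ideal (Ext K n)) where
  /-- index set of the homogeneous basis of `F_i` -/
  B : ℕ → Type
  finite_B : ∀ i, Finite (B i)
  /-- degrees of the basis elements -/
  deg : ∀ i, B i → ℤ
  /-- the differential `F_{i+1} → F_i` -/
  d : ∀ i, (B (i + 1) →₀ Ext K n) →ₗ[Ext K n] (B i →₀ Ext K n)
  /-- the augmentation `F_0 → I ⊆ E` -/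
  ε : (B 0 →₀ Ext K n) →ₗ[Ext K n] Ext K n
  d_homog : ∀ i k x, IsHomog (deg (i + 1)) k x → IsHomog (deg i) k (d i x)
  ε_homog : ∀ k x, IsHomog (deg 0) k x → ε x ≠ 0 →
    ∃ p : ℕ, (p : ℤ) = k ∧ ε x ∈ ⋀[K]^p (Fin n → K)
  range_ε : LinearMap.range ε = I
  exact_zero : LinearMap.range (d 0) = LinearMap.ker ε
  exact_succ : ∀ i, LinearMap.range (d (i + 1)) = LinearMap.ker (d i)
  /-- minimality: `d(F_{i+1}) ⊆ 𝔪 F_i` with `𝔪 = (e_1, …, e_n)` -/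
  minimal : ∀ i x b, d i x b ∈ Ideal.span (Set.range (e K : Fin n → Ext K n))

/-- The number of copies of `E(-k)` in `F_i`, for a minimal graded free resolution `F` of `I`; this
is the graded Betti number `β_{i,k}(I)`. -/
def MinGradedFreeRes.betti {K : Type*} [Field K] {n : ℕ} {I : Ideal (Ext K n)}
    (F : MinGradedFreeRes I) (i : ℕ) (k : ℤ) : ℕ :=
  Nat.card {b : F.B i // F.deg i b = k}

end VectorSpread

end

/-! ### Monomial basis of the exterior algebra and monomial ideals. -/

noncomputable section

namespace VectorSpread

open Module

variable {K : Type*} [Field K] {n : ℕ}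

/-! Order the minimal generators by degree, then by a weight that drops when an index is lowered.
The ideal then has linear quotients: the colon ideal of a generator `u` modulo its predecessors is
generated by variables (`IsSpreadStronglyStable.mul_monomial_mem_iff`). These are the `e_a` with `a
≤ m(u)` lying in none of the forbidden gaps `i_h < a < i_h + t_h`, `h < deg u`. The variables
dividing `u` are among them, since they annihilate `u`. The gaps are disjoint and lie below `m(u)`,
so `m(u) - ∑ max{t_h - 1, 0}` variables remain (`IsSpread.card_colonVars`).

Over the exterior algebra linear quotients pass to syzygies (`LinQuot.linQuot_syz`). If the colon
ideal at `k` is generated by the variables in `A k`, there is one syzygy with leading term `e_a` at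
`k` for each `a ∈ A k`, and its colon ideal is generated by the `e_b` with `b ∈ A k`, `b ≤ a`; the
case `b = a` reflects `e_a ^ 2 = 0`. A set of `r` variables is thus replaced by sets of sizes `1, …,
r`, and the hockey-stick identity for `multichoose` shows that `u` contributes `multichoose r i`
basis elements in homological degree `i`, all of degree `i + deg u`.

The syzygies have coefficients in the maximal ideal, so iterating them yields a minimal resolution.
For an arbitrary minimal resolution, graded Nakayama (`exists_iso_of_minimal`) identifies each step
with the one built from the syzygies, and linear quotients are carried along the isomorphism. -/

theorem monomial_eq_ιMulti (μ : Finset (Fin n)) {l : ℕ} (h : μ.card = l) :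
    monomial K μ = ExteriorAlgebra.ιMulti K l
      (fun i => Pi.single (μ.orderEmbOfFin h i) (1 : K)) := by
  subst h
  rw [ExteriorAlgebra.ιMulti_apply, monomial]
  congr 1
  apply List.ext_getElem
  · simp
  · intro i h1 h2
    simp [e, Finset.orderEmbOfFin_apply]

variable (K n) in
/-- The monomials form a `K`-basis of the exterior algebra. -/
def monomialBasis : Basis (Finset (Fin n)) K (Ext K n) :=
  (Pi.basisFun K (Fin n)).ExteriorAlgebra

theorem monomialBasis_apply (μ : Finset (Fin n)) : monomialBasis K n μ = monomial K μ := by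
  rw [monomialBasis, ExteriorAlgebra.basis_apply_ofCard (n := μ.card) _ rfl,
    monomial_eq_ιMulti μ rfl]
  simp only [ExteriorAlgebra.ιMulti_family]
  congr 1
  funext i
  simp [Set.powersetCard.ofFinEmbEquiv_symm_apply]

theorem monomial_mem (μ : Finset (Fin n)) : monomial K μ ∈ ⋀[K]^μ.card (Fin n → K) := by
  rw [monomial_eq_ιMulti μ rfl]
  exact ExteriorAlgebra.ιMulti_range K _ ⟨_, rfl⟩

theorem monomial_singleton (i : Fin n) : monomial K {i} = e K i := by
  simp [monomial]

theorem monomial_mul_of_not_disjoint {ν μ : Finset (Fin n)} (h : ¬ Disjoint ν μ) :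
    monomial K ν * monomial K μ = 0 := by
  rw [← monomialBasis_apply, ← monomialBasis_apply]
  exact ExteriorAlgebra.basis_mul_of_not_disjoint (Pi.basisFun K (Fin n))
    (Set.powersetCard.ofCard (s := ν) rfl) (Set.powersetCard.ofCard (s := μ) rfl) h

theorem exists_sign (ν μ : Finset (Fin n)) : ∃ c : K, c ≠ 0 ∧
    monomial K ν * monomial K μ = if Disjoint ν μ then c • monomial K (ν ∪ μ) else 0 := by
  by_cases h : Disjoint ν μ
  · have := ExteriorAlgebra.basis_mul_of_disjoint (Pi.basisFun K (Fin n))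
      (Set.powersetCard.ofCard (s := ν) rfl) (Set.powersetCard.ofCard (s := μ) rfl) h
    obtain ⟨u, hu⟩ : ∃ u : ℤˣ, monomial K ν * monomial K μ = u • monomial K (ν ∪ μ) := by
      simp only [← monomialBasis_apply]
      refine ⟨Equiv.Perm.sign (Set.powersetCard.permOfDisjoint
        (s := Set.powersetCard.ofCard (s := ν) rfl)
        (t := Set.powersetCard.ofCard (s := μ) rfl) h), this.trans ?_⟩
      congr 2
      ext i
      simp [Set.powersetCard.disjUnion]
    rcases Int.units_eq_one_or u with rfl | rfl
    · exact ⟨1, one_ne_zero, by simp [h, hu]⟩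
    · exact ⟨-1, by simp, by rw [hu, if_pos h]; simp⟩
  · exact ⟨1, one_ne_zero, by simp [h, monomial_mul_of_not_disjoint]⟩

/-- The sign relating `e_ν ∧ e_μ` to `e_{ν ∪ μ}`. -/
def sign (K : Type*) [Field K] {n : ℕ} (ν μ : Finset (Fin n)) : K := (exists_sign ν μ).choose

theorem sign_ne_zero (ν μ : Finset (Fin n)) : sign K ν μ ≠ 0 := (exists_sign ν μ).choose_spec.1

theorem monomial_mul (ν μ : Finset (Fin n)) : monomial K ν * monomial K μ =
    if Disjoint ν μ then sign K ν μ • monomial K (ν ∪ μ) else 0 :=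
  (exists_sign ν μ).choose_spec.2

/-- The coefficient of `e_ρ`. -/
def coeff (ρ : Finset (Fin n)) : Ext K n →ₗ[K] K := (monomialBasis K n).coord ρ

theorem coeff_monomial (ρ μ : Finset (Fin n)) :
    coeff ρ (monomial K μ) = if μ = ρ then 1 else 0 := by
  rw [← monomialBasis_apply]
  simp [coeff, Finsupp.single_apply]

theorem sum_coeff_smul (x : Ext K n) : ∑ ρ, coeff ρ x • monomial K ρ = x := by
  simpa [monomialBasis_apply, coeff] using (monomialBasis K n).sum_repr x

/-- Right multiplication by `e_μ` kills the monomials meeting `μ` and sends the others to multiples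
of distinct monomials, so at most one coefficient of `x` contributes. -/
theorem coeff_mul_monomial (x : Ext K n) (μ σ : Finset (Fin n)) :
    coeff σ (x * monomial K μ) =
      if μ ⊆ σ then sign K (σ \ μ) μ * coeff (σ \ μ) x else 0 := by
  conv_lhs => rw [← sum_coeff_smul x]
  rw [Finset.sum_mul, map_sum]
  have key : ∀ ρ, coeff σ (coeff ρ x • monomial K ρ * monomial K μ) =
      if ρ = σ \ μ then (if μ ⊆ σ then sign K (σ \ μ) μ * coeff (σ \ μ) x else 0) else 0 := by
    intro ρ
    rw [smul_mul_assoc, monomial_mul]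
    by_cases hd : Disjoint ρ μ
    · rw [if_pos hd]
      simp only [map_smul, coeff_monomial, smul_eq_mul]
      by_cases h : ρ ∪ μ = σ
      · subst h
        have : (ρ ∪ μ) \ μ = ρ := by
          rw [Finset.union_sdiff_right]; exact Finset.sdiff_eq_self_of_disjoint hd
        simp [this, mul_comm]
      · rw [if_neg h]
        by_cases h1 : ρ = σ \ μ
        · rw [if_pos h1, if_neg, mul_zero, mul_zero]
          rintro h2
          exact h (by rw [h1, Finset.sdiff_union_of_subset h2])
        · simp [h1]
    · rw [if_neg hd, if_neg]
      · simp
      · rintro rfl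
        exact hd Finset.sdiff_disjoint
  simp only [key]
  simp

/-- Products of monomials are scalar multiples of monomials, so a monomial ideal is spanned over `K`
by the monomials it contains. Every later ideal membership thereby becomes a question about
supports. -/
theorem mem_span_monomial {S : Set (Finset (Fin n))} {x : Ext K n} :
    x ∈ Ideal.span (monomial K '' S) ↔ ∀ ρ, coeff ρ x ≠ 0 → ∃ ν ∈ S, ν ⊆ ρ := by
  constructor
  · intro hx
    induction hx using Submodule.span_induction with
    | mem x hx =>
      obtain ⟨ν, hν, rfl⟩ := hx
      intro ρ hρ
      rw [coeff_monomial] at hρ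
      exact ⟨ν, hν, by aesop⟩
    | zero => simp
    | add x y _ _ hx hy =>
      intro ρ hρ
      by_cases h : coeff ρ x = 0
      · exact hy ρ (by simpa [h] using hρ)
      · exact hx ρ h
    | smul a x _ hx =>
      intro ρ hρ
      rw [smul_eq_mul] at hρ
      conv at hρ => rw [← sum_coeff_smul x]
      rw [Finset.mul_sum, map_sum] at hρ
      obtain ⟨μ, -, hμ⟩ := Finset.exists_ne_zero_of_sum_ne_zero hρ
      rw [mul_smul_comm, map_smul, coeff_mul_monomial] at hμ
      by_cases h : μ ⊆ ρ
      · obtain ⟨ν, hν, h'⟩ := hx μ (by aesop)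
        exact ⟨ν, hν, h'.trans h⟩
      · simp [h] at hμ
  · intro h
    rw [← sum_coeff_smul x]
    refine Submodule.sum_mem _ fun ρ _ => ?_
    by_cases h0 : coeff ρ x = 0
    · simp [h0]
    obtain ⟨ν, hν, hs⟩ := h ρ h0
    have : monomial K ρ = ((sign K (ρ \ ν) ν)⁻¹ • monomial K (ρ \ ν)) * monomial K ν := by
      rw [smul_mul_assoc, monomial_mul, if_pos Finset.sdiff_disjoint,
        Finset.sdiff_union_of_subset hs, smul_smul, inv_mul_cancel₀ (sign_ne_zero _ _), one_smul]
    rw [this, ← smul_mul_assoc]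
    exact Ideal.mul_mem_left _ _ (Ideal.subset_span ⟨ν, hν, rfl⟩)

theorem monomial_mem_span_monomial {S : Set (Finset (Fin n))} {μ : Finset (Fin n)} :
    monomial K μ ∈ Ideal.span (monomial K '' S) ↔ ∃ ν ∈ S, ν ⊆ μ := by
  rw [mem_span_monomial]
  simp [coeff_monomial]

theorem mul_monomial_mem_span_monomial {S : Set (Finset (Fin n))} {x : Ext K n}
    {μ : Finset (Fin n)} :
    x * monomial K μ ∈ Ideal.span (monomial K '' S) ↔
      ∀ ρ, coeff ρ x ≠ 0 → Disjoint ρ μ → ∃ ν ∈ S, ν ⊆ ρ ∪ μ := by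
  rw [mem_span_monomial]
  constructor
  · intro h ρ hρ hd
    refine h _ ?_
    have : (ρ ∪ μ) \ μ = ρ := by
      rw [Finset.union_sdiff_right]; exact Finset.sdiff_eq_self_of_disjoint hd
    rw [coeff_mul_monomial, if_pos Finset.subset_union_right, this]
    exact mul_ne_zero (sign_ne_zero _ _) hρ
  · intro h σ hσ
    rw [coeff_mul_monomial] at hσ
    by_cases hs : μ ⊆ σ
    · rw [if_pos hs] at hσ
      obtain ⟨ν, hν, h'⟩ := h _ (right_ne_zero_of_mul hσ) Finset.sdiff_disjoint
      exact ⟨ν, hν, by rwa [Finset.sdiff_union_of_subset hs] at h'⟩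
    · simp [hs] at hσ

theorem mem_span_e {A : Set (Fin n)} {x : Ext K n} :
    x ∈ Ideal.span (e K '' A) ↔ ∀ ρ, coeff ρ x ≠ 0 → ∃ a ∈ A, a ∈ ρ := by
  have : (e K '' A : Set (Ext K n)) = monomial K '' ((fun a => {a}) '' A) := by
    rw [Set.image_image]; simp [monomial_singleton]
  rw [this, mem_span_monomial]
  simp

/-- The colon ideal of `e_b` gains the generator `e_b` itself because `e_b ^ 2 = 0`; over a
polynomial ring it would not. -/
theorem mul_e_mem_span_e {A : Set (Fin n)} {x : Ext K n} {b : Fin n} (hb : b ∉ A) :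
    x * e K b ∈ Ideal.span (e K '' A) ↔ x ∈ Ideal.span (e K '' insert b A) := by
  have : (e K '' A : Set (Ext K n)) = monomial K '' ((fun a => {a}) '' A) := by
    rw [Set.image_image]; simp [monomial_singleton]
  rw [this, mem_span_e, ← monomial_singleton, mul_monomial_mem_span_monomial]
  refine forall_congr' fun ρ => imp_congr_right fun _ => ?_
  simp only [Finset.disjoint_singleton_right, Set.mem_image, exists_exists_and_eq_and,
    Finset.singleton_subset_iff, Finset.mem_union, Finset.mem_singleton, Set.mem_insert_iff]
  constructor
  · intro h
    by_cases hρ : b ∈ ρ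
    · exact ⟨b, .inl rfl, hρ⟩
    · obtain ⟨a, ha, ha'⟩ := h hρ
      exact ⟨a, .inr ha, ha'.resolve_right (by rintro rfl; exact hb ha)⟩
  · rintro ⟨a, rfl | ha, ha'⟩ hρ
    · exact absurd ha' hρ
    · exact ⟨a, ha, .inl ha'⟩

/-- The graded maximal ideal. -/
abbrev maxIdeal (K : Type*) [Field K] (n : ℕ) : Ideal (Ext K n) :=
  Ideal.span (Set.range (e K : Fin n → Ext K n))

/-- The residue map `E → K`. -/
abbrev residue : Ext K n →ₐ[K] K := ExteriorAlgebra.algebraMapInv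

theorem residue_eq_zero {x : Ext K n} (hx : x ∈ maxIdeal K n) : residue x = 0 := by
  induction hx using Submodule.span_induction with
  | mem x hx =>
    obtain ⟨i, rfl⟩ := hx
    simp [e, residue, ExteriorAlgebra.algebraMapInv]
  | zero => simp
  | add x y _ _ hx hy => simp [hx, hy]
  | smul a x _ hx => simp [hx]

theorem mem_maxIdeal_of_mem {x : Ext K n} {p : ℕ} (hp : p ≠ 0)
    (hx : x ∈ ⋀[K]^p (Fin n → K)) : x ∈ maxIdeal K n := by
  obtain ⟨p, rfl⟩ := Nat.exists_eq_succ_of_ne_zero hp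
  rw [ExteriorAlgebra.exteriorPower, pow_succ] at hx
  refine Submodule.mul_induction_on hx ?_ fun x y hx hy => add_mem hx hy
  · rintro a - _ hb
    obtain ⟨v, rfl⟩ := hb
    refine Ideal.mul_mem_left _ _ ?_
    rw [pi_eq_sum_univ v, map_sum]
    refine Submodule.sum_mem _ fun i _ => ?_
    rw [map_smul, Algebra.smul_def]
    refine Ideal.mul_mem_left _ _ (Ideal.subset_span ⟨i, ?_⟩)
    rw [e]
    congr 1
    ext j
    simp [Pi.single_apply, eq_comm]

theorem eq_zero_of_mem_maxIdeal {x : Ext K n} (hx : x ∈ ⋀[K]^0 (Fin n → K))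
    (h : x ∈ maxIdeal K n) : x = 0 := by
  rw [ExteriorAlgebra.exteriorPower, pow_zero, Submodule.mem_one] at hx
  obtain ⟨c, rfl⟩ := hx
  have := residue_eq_zero h
  simp at this
  simp [this]

instance : Module.Finite K (Ext K n) := Module.Finite.of_basis (monomialBasis K n)

end VectorSpread

end

/-! ### Homogeneous components in graded free modules. -/

noncomputable section

namespace VectorSpread

open Module

variable {K : Type*} [Field K] {n : ℕ}

/-- The projection of `E` onto its component of degree `z`. -/
def projZ (z : ℤ) : Ext K n →+ Ext K n :=
  if 0 ≤ z then GradedRing.proj (fun i : ℕ => ⋀[K]^i (Fin n → K)) z.toNat else 0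

theorem projZ_natCast (p : ℕ) (x : Ext K n) :
    projZ (p : ℤ) x = DirectSum.decompose (fun i : ℕ => ⋀[K]^i (Fin n → K)) x p := by
  simp [projZ, GradedRing.proj_apply]

theorem projZ_of_neg {z : ℤ} (hz : z < 0) (x : Ext K n) : projZ z x = 0 := by
  simp [projZ, not_le.2 hz]

theorem exists_of_projZ_ne_zero {z : ℤ} {x : Ext K n} (h : projZ z x ≠ 0) :
    ∃ p : ℕ, (p : ℤ) = z ∧ projZ z x ∈ ⋀[K]^p (Fin n → K) := by
  rcases lt_or_ge z 0 with hz | hz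
  · exact absurd (projZ_of_neg hz x) h
  · lift z to ℕ using hz
    refine ⟨z, rfl, ?_⟩
    rw [projZ_natCast]
    exact SetLike.coe_mem _

theorem projZ_of_mem {p : ℕ} {x : Ext K n} (hx : x ∈ ⋀[K]^p (Fin n → K)) :
    projZ (p : ℤ) x = x := by
  rw [projZ_natCast]
  exact DirectSum.decompose_of_mem_same _ hx

theorem projZ_mul {p : ℕ} {y : Ext K n} (hy : y ∈ ⋀[K]^p (Fin n → K)) (z : ℤ) (x : Ext K n) :
    projZ (z + p) (x * y) = projZ z x * y := by
  rcases lt_or_ge z 0 with hz | hz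
  · rw [projZ_of_neg hz, zero_mul]
    rcases lt_or_ge (z + p) 0 with hz' | hz'
    · exact projZ_of_neg hz' _
    · obtain ⟨m, hm⟩ := Int.eq_ofNat_of_zero_le hz'
      rw [hm, projZ_natCast]
      exact DirectSum.coe_decompose_mul_of_right_mem_of_not_le _ hy (by omega)
  · lift z to ℕ using hz
    rw [← Nat.cast_add, projZ_natCast, projZ_natCast]
    exact DirectSum.coe_decompose_mul_add_of_right_mem _ hy

variable {B C : Type} {deg : B → ℤ} {degC : C → ℤ}

theorem IsHomog.add {k : ℤ} {x y : B →₀ Ext K n} (hx : IsHomog deg k x) (hy : IsHomog deg k y) :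
    IsHomog deg k (x + y) := by
  intro b hb
  by_cases h1 : x b = 0
  · simp only [Finsupp.add_apply, h1, zero_add] at hb ⊢
    exact hy b hb
  by_cases h2 : y b = 0
  · simp only [Finsupp.add_apply, h2, add_zero] at hb ⊢
    exact hx b hb
  obtain ⟨p, hp, h1⟩ := hx b h1
  obtain ⟨q, hq, h2⟩ := hy b h2
  obtain rfl : p = q := by omega
  exact ⟨p, hp, add_mem h1 h2⟩

theorem IsHomog.neg {k : ℤ} {x : B →₀ Ext K n} (hx : IsHomog deg k x) :
    IsHomog deg k (-x) := by
  intro b hb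
  obtain ⟨p, hp, h⟩ := hx b (by simpa using hb)
  exact ⟨p, hp, by simpa using h⟩

theorem IsHomog.sub {k : ℤ} {x y : B →₀ Ext K n} (hx : IsHomog deg k x) (hy : IsHomog deg k y) :
    IsHomog deg k (x - y) := by
  rw [sub_eq_add_neg]
  exact hx.add hy.neg

theorem IsHomog.smul {k : ℤ} {x : B →₀ Ext K n} (hx : IsHomog deg k x) {p : ℕ} {a : Ext K n}
    (ha : a ∈ ⋀[K]^p (Fin n → K)) : IsHomog deg (k + p) (a • x) := by
  intro b hb
  obtain ⟨q, hq, h⟩ := hx b (by rintro h; simp [h] at hb)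
  refine ⟨p + q, by push_cast; omega, ?_⟩
  exact SetLike.mul_mem_graded (A := fun i : ℕ => ⋀[K]^i (Fin n → K)) ha h

theorem isHomog_single (b : B) : IsHomog deg (deg b) (Finsupp.single b (1 : Ext K n)) := by
  intro c hc
  classical
  rw [Finsupp.single_apply] at hc ⊢
  have h : b = c := by by_contra h; simp [h] at hc
  subst h
  refine ⟨0, by simp, ?_⟩
  rw [if_pos rfl, ExteriorAlgebra.exteriorPower, pow_zero]
  exact Submodule.mem_one.2 ⟨1, map_one _⟩

theorem e_mem (i : Fin n) : e K i ∈ ⋀[K]^1 (Fin n → K) := by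
  rw [ExteriorAlgebra.exteriorPower, pow_one]
  exact ⟨_, rfl⟩

/-- The projection of a graded free module onto its component of degree `k`. -/
def comp (deg : B → ℤ) (k : ℤ) : (B →₀ Ext K n) →+ (B →₀ Ext K n) :=
  Finsupp.liftAddHom fun b => (Finsupp.singleAddHom b).comp (projZ (k - deg b))

theorem comp_apply (k : ℤ) (x : B →₀ Ext K n) (b : B) :
    comp deg k x b = projZ (k - deg b) (x b) := by
  classical
  induction x using Finsupp.induction_linear with
  | zero => simp
  | add x y hx hy => simp [hx, hy]
  | single c a =>
    simp only [comp, Finsupp.liftAddHom_apply_single, AddMonoidHom.coe_comp, Function.comp_apply,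
      Finsupp.singleAddHom_apply, Finsupp.single_apply]
    split_ifs with h
    · rw [h]
    · simp

theorem isHomog_comp (k : ℤ) (x : B →₀ Ext K n) : IsHomog deg k (comp deg k x) := by
  intro b hb
  rw [comp_apply] at hb ⊢
  obtain ⟨p, hp, h⟩ := exists_of_projZ_ne_zero hb
  exact ⟨p, by omega, h⟩

theorem IsHomog.comp_eq {k : ℤ} {x : B →₀ Ext K n} (hx : IsHomog deg k x) :
    comp deg k x = x := by
  ext b
  rw [comp_apply]
  by_cases h : x b = 0
  · simp [h]
  · obtain ⟨p, hp, h⟩ := hx b h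
    rw [show k - deg b = p by omega, projZ_of_mem h]

theorem IsHomog.comp_smul {d : ℤ} {y : B →₀ Ext K n} (hy : IsHomog deg d y) (k : ℤ)
    (a : Ext K n) : comp deg k (a • y) = projZ (k - d) a • y := by
  ext b
  rw [comp_apply, Finsupp.smul_apply, Finsupp.smul_apply, smul_eq_mul, smul_eq_mul]
  by_cases h : y b = 0
  · simp [h]
  · obtain ⟨p, hp, h⟩ := hy b h
    rw [← projZ_mul h]
    congr 2
    omega

/-- An `E`-linear map of graded free modules that is homogeneous of degree `0`, checked on the
basis. -/
def HomogOnBasis (deg : B → ℤ) (degC : C → ℤ) (f : (B →₀ Ext K n) →ₗ[Ext K n] (C →₀ Ext K n)) :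
    Prop :=
  ∀ b, IsHomog degC (deg b) (f (Finsupp.single b 1))

theorem HomogOnBasis.comp_map {f : (B →₀ Ext K n) →ₗ[Ext K n] (C →₀ Ext K n)}
    (hf : HomogOnBasis deg degC f) (k : ℤ) (x : B →₀ Ext K n) :
    comp degC k (f x) = f (comp deg k x) := by
  induction x using Finsupp.induction_linear with
  | zero => simp
  | add x y hx hy => simp [hx, hy]
  | single b a =>
    have h1 : ∀ a : Ext K n, Finsupp.single b a = a • Finsupp.single b 1 := by simp
    rw [h1, map_smul, (hf b).comp_smul, (isHomog_single b).comp_smul, map_smul]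

theorem HomogOnBasis.isHomog {f : (B →₀ Ext K n) →ₗ[Ext K n] (C →₀ Ext K n)}
    (hf : HomogOnBasis deg degC f) {k : ℤ} {x : B →₀ Ext K n} (hx : IsHomog deg k x) :
    IsHomog degC k (f x) := by
  rw [← hx.comp_eq, ← hf.comp_map]
  exact isHomog_comp _ _

/-- An element of the image of a homogeneous map has a homogeneous preimage. -/
theorem HomogOnBasis.exists_preimage {f : (B →₀ Ext K n) →ₗ[Ext K n] (C →₀ Ext K n)}
    (hf : HomogOnBasis deg degC f) {k : ℤ} {y : C →₀ Ext K n} (hy : IsHomog degC k y)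
    (h : y ∈ LinearMap.range f) : ∃ x, IsHomog deg k x ∧ f x = y := by
  obtain ⟨x, rfl⟩ := h
  exact ⟨comp deg k x, isHomog_comp _ _, by rw [← hf.comp_map, hy.comp_eq]⟩

theorem comp_mem_supported (k : ℤ) (x : B →₀ Ext K n) {s : Set B}
    (hx : ∀ b ∉ s, x b = 0) : ∀ b ∉ s, comp deg k x b = 0 := by
  intro b hb
  rw [comp_apply, hx b hb, map_zero]

end VectorSpread

end

/-! ### Linear quotients and their syzygies. -/

noncomputable section

namespace VectorSpread

open Module

variable {K : Type*} [Field K] {n : ℕ}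

/-- The sequence `g` of homogeneous elements of degrees `δ` of a graded free module has linear
quotients: the colon ideal of `g k` modulo the previous elements is generated by the variables
indexed by `A k`. -/
structure LinQuot {C ι : Type} [LinearOrder ι] (degC : C → ℤ) (δ : ι → ℤ)
    (A : ι → Finset (Fin n)) (g : ι → (C →₀ Ext K n)) : Prop where
  mono : Monotone δ
  homog : ∀ k, IsHomog degC (δ k) (g k)
  colon : ∀ k x, x • g k ∈ Submodule.span (Ext K n) (g '' Set.Iio k) ↔
    x ∈ Ideal.span (e K '' (A k : Set (Fin n)))

/-- The index set of the syzygies of a sequence with linear quotients. -/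
abbrev SyzIndex {ι : Type} (A : ι → Finset (Fin n)) : Type := Σₗ k, (A k : Type)

variable {C ι : Type} [LinearOrder ι] {degC : C → ℤ} {δ : ι → ℤ}
  {A : ι → Finset (Fin n)} {g : ι → (C →₀ Ext K n)}

theorem LinQuot.homogOnBasis (h : LinQuot degC δ A g) :
    HomogOnBasis δ degC (Finsupp.linearCombination (Ext K n) g) := by
  intro k
  simpa using h.homog k

/-- Since `e_a` lies in the colon ideal at `k`, `e_a • g k` is a combination of earlier elements;
the difference of the two sides is the syzygy. -/
theorem LinQuot.exists_syzygy (h : LinQuot degC δ A g) (k : ι) (a : A k) :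
    ∃ s : ι →₀ Ext K n, Finsupp.linearCombination (Ext K n) g s = 0 ∧
      IsHomog δ (δ k + 1) s ∧ s k = e K a.1 ∧ (∀ j, k < j → s j = 0) ∧
      ∀ j, s j ∈ maxIdeal K n := by
  have h1 : e K a.1 • g k ∈ Submodule.span (Ext K n) (g '' Set.Iio k) :=
    (h.colon k _).2 (Ideal.subset_span ⟨a.1, a.2, rfl⟩)
  obtain ⟨c, hc, hcg⟩ := (Finsupp.mem_span_image_iff_linearCombination _).1 h1
  have hc0 : ∀ j ∉ Set.Iio k, c j = 0 := by
    intro j hj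
    by_contra h0
    exact hj (hc (Finsupp.mem_support_iff.2 h0))
  have hhom : IsHomog degC (δ k + 1) (e K a.1 • g k) := by
    simpa using (h.homog k).smul (e_mem a.1)
  -- Passing to the component of the right degree makes the coefficients homogeneous without
  -- enlarging the support.
  set c' := comp δ (δ k + 1) c with hc'
  have hc'0 : ∀ j ∉ Set.Iio k, c' j = 0 := comp_mem_supported _ _ hc0
  have hc'g : Finsupp.linearCombination (Ext K n) g c' = e K a.1 • g k := by
    rw [hc', ← h.homogOnBasis.comp_map, hcg, hhom.comp_eq]
  have hc'h : IsHomog δ (δ k + 1) c' := isHomog_comp _ _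
  refine ⟨e K a.1 • Finsupp.single k 1 - c', ?_, ?_, ?_, ?_, ?_⟩
  · rw [map_sub, hc'g, map_smul]
    simp
  · refine IsHomog.sub ?_ hc'h
    simpa using (isHomog_single (deg := δ) k).smul (e_mem (K := K) a.1)
  · simp [hc'0 k (by simp)]
  · intro j hj
    simp [hc'0 j (by simpa using hj.le), hj.ne]
  · intro j
    rcases lt_or_ge j k with hj | hj
    · have : (e K a.1 • Finsupp.single k 1 - c' : ι →₀ Ext K n) j = - c' j := by
        simp [hj.ne']
      rw [this, neg_mem_iff]
      by_cases h0 : c' j = 0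
      · simp [h0]
      · obtain ⟨p, hp, hm⟩ := hc'h j h0
        -- The coefficient has degree `δ k + 1 - δ j ≥ 1`; this is where monotonicity of the degrees
        -- is needed.
        have := h.mono hj.le
        exact mem_maxIdeal_of_mem (by omega) hm
    · have : (e K a.1 • Finsupp.single k 1 - c' : ι →₀ Ext K n) j =
          e K a.1 * Finsupp.single k 1 j := by
        rw [Finsupp.sub_apply, hc'0 j (by simpa using hj), sub_zero, Finsupp.smul_apply,
          smul_eq_mul]
      rw [this]
      classical
      rw [Finsupp.single_apply]
      split_ifs
      · rw [mul_one]; exact Ideal.subset_span ⟨_, rfl⟩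
      · simp

/-- The chosen syzygy of `g` with leading term `e_a` at `k`. -/
def LinQuot.syz (h : LinQuot degC δ A g) (p : SyzIndex A) : ι →₀ Ext K n :=
  (h.exists_syzygy p.1 p.2).choose

section
variable (h : LinQuot degC δ A g)
include h

theorem LinQuot.linearCombination_syz (p : SyzIndex A) :
    Finsupp.linearCombination (Ext K n) g (h.syz p) = 0 :=
  (h.exists_syzygy p.1 p.2).choose_spec.1

theorem LinQuot.isHomog_syz (p : SyzIndex A) : IsHomog δ (δ p.1 + 1) (h.syz p) :=
  (h.exists_syzygy p.1 p.2).choose_spec.2.1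

theorem LinQuot.syz_self (p : SyzIndex A) : h.syz p p.1 = e K p.2.1 :=
  (h.exists_syzygy p.1 p.2).choose_spec.2.2.1

theorem LinQuot.syz_of_lt (p : SyzIndex A) {j : ι} (hj : p.1 < j) : h.syz p j = 0 :=
  (h.exists_syzygy p.1 p.2).choose_spec.2.2.2.1 j hj

theorem LinQuot.syz_mem (p : SyzIndex A) (j : ι) : h.syz p j ∈ maxIdeal K n :=
  (h.exists_syzygy p.1 p.2).choose_spec.2.2.2.2 j

/-- The leading coefficients of the syzygies at `k` are the variables, so a suitable combination of
them cancels any `k`-th coordinate lying in the ideal of those variables. -/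
theorem LinQuot.exists_mem_span_syz (k : ι) (T : Set (Fin n)) (hT : ∀ a ∈ T, a ∈ A k) {x : Ext K n}
    (hx : x ∈ Ideal.span (e K '' T)) :
    ∃ z ∈ Submodule.span (Ext K n) (h.syz '' {p | p.1 = k ∧ p.2.1 ∈ T}), z k = x := by
  have : Ideal.span (e K '' T) ≤ (Submodule.span (Ext K n)
      (h.syz '' {p | p.1 = k ∧ p.2.1 ∈ T})).map (Finsupp.lapply k) := by
    refine Ideal.span_le.2 ?_
    rintro _ ⟨a, ha, rfl⟩
    exact ⟨h.syz ⟨k, a, hT a ha⟩, Submodule.subset_span ⟨_, ⟨rfl, ha⟩, rfl⟩,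
      h.syz_self ⟨k, a, hT a ha⟩⟩
  obtain ⟨z, hz, hzx⟩ := this hx
  exact ⟨z, hz, hzx⟩

theorem LinQuot.span_syz_le_ker (s : Set (SyzIndex A)) :
    Submodule.span (Ext K n) (h.syz '' s) ≤
      LinearMap.ker (Finsupp.linearCombination (Ext K n) g) := by
  refine Submodule.span_le.2 ?_
  rintro _ ⟨p, -, rfl⟩
  exact h.linearCombination_syz p

theorem LinQuot.apply_eq_zero_of_mem_span_syz (k : ι) {s : Set (SyzIndex A)}
    (hs : ∀ p ∈ s, p.1 < k) {z : ι →₀ Ext K n}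
    (hz : z ∈ Submodule.span (Ext K n) (h.syz '' s)) : z k = 0 := by
  have : Submodule.span (Ext K n) (h.syz '' s) ≤ LinearMap.ker (Finsupp.lapply k) := by
    refine Submodule.span_le.2 ?_
    rintro _ ⟨p, hp, rfl⟩
    exact h.syz_of_lt p (hs p hp)
  exact this hz

end

theorem exists_max_ne_zero {x : ι →₀ Ext K n} (hx : x ≠ 0) :
    ∃ k, x k ≠ 0 ∧ ∀ j, k < j → x j = 0 := by
  have hne : x.support.Nonempty := by simpa using hx
  refine ⟨x.support.max' hne, by simpa using x.support.max'_mem hne, fun j hj => ?_⟩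
  by_contra h0
  exact (x.support.le_max' j (by simpa using h0)).not_gt hj

variable [Finite ι]

/-- Induction on a bound for the last nonzero coordinate. The coordinate at `k` lies in the colon
ideal, so the chosen syzygies cancel it and leave a syzygy that ends earlier. -/
theorem LinQuot.mem_span_syz (h : LinQuot degC δ A g) (k : ι) :
    ∀ x ∈ LinearMap.ker (Finsupp.linearCombination (Ext K n) g), (∀ j, k < j → x j = 0) →
      x ∈ Submodule.span (Ext K n) (h.syz '' {p | p.1 ≤ k}) := by
  induction k using WellFoundedLT.induction with
  | ind k ih =>
    intro x hx hx0
    have hxk : x k • g k ∈ Submodule.span (Ext K n) (g '' Set.Iio k) := by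
      have h1 : x k • g k = Finsupp.linearCombination (Ext K n) g (-(x.erase k)) := by
        have h2 := congrArg (Finsupp.linearCombination (Ext K n) g) (Finsupp.single_add_erase k x)
        rw [map_add, LinearMap.mem_ker.1 hx, Finsupp.linearCombination_single] at h2
        rw [map_neg, eq_neg_iff_add_eq_zero, h2]
      rw [h1]
      refine (Finsupp.mem_span_image_iff_linearCombination _).2 ⟨_, ?_, rfl⟩
      intro j hj
      rw [Finset.mem_coe, Finsupp.mem_support_iff, Finsupp.neg_apply, neg_ne_zero] at hj
      have hjk : j ≠ k := by rintro rfl; simp at hj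
      rw [Finsupp.erase_ne hjk] at hj
      by_contra hlt
      exact hj (hx0 j (lt_of_le_of_ne (not_lt.1 hlt) hjk.symm))
    obtain ⟨z, hz, hzk⟩ := h.exists_mem_span_syz k _ (fun _ ha => ha) ((h.colon k _).1 hxk)
    have hz' : z ∈ Submodule.span (Ext K n) (h.syz '' {p | p.1 ≤ k}) :=
      Submodule.span_mono (Set.image_mono fun p hp => hp.1.le) hz
    suffices x - z ∈ Submodule.span (Ext K n) (h.syz '' {p | p.1 ≤ k}) by
      simpa using add_mem this hz'
    by_cases h0 : x - z = 0
    · simp [h0]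
    obtain ⟨l, hl, hl0⟩ := exists_max_ne_zero h0
    have hlk : l < k := by
      by_contra hkl
      rcases (not_lt.1 hkl).eq_or_lt with rfl | hkl
      · exact hl (by simp [hzk])
      · apply hl
        rw [Finsupp.sub_apply, hx0 l hkl,
          h.apply_eq_zero_of_mem_span_syz l (fun p hp => hp.1.trans_lt hkl) hz, sub_zero]
    refine Submodule.span_mono (Set.image_mono fun p hp => ?_)
      (ih l hlk _ (sub_mem hx (h.span_syz_le_ker _ hz)) hl0)
    exact le_trans hp hlk.le

theorem LinQuot.span_syz (h : LinQuot degC δ A g) :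
    Submodule.span (Ext K n) (Set.range h.syz) =
      LinearMap.ker (Finsupp.linearCombination (Ext K n) g) := by
  refine le_antisymm ?_ fun x hx => ?_
  · rw [← Set.image_univ]
    exact h.span_syz_le_ker _
  · by_cases h0 : x = 0
    · simp [h0]
    obtain ⟨k, -, hk⟩ := exists_max_ne_zero h0
    exact Submodule.span_mono (Set.image_subset_range _ _) (h.mem_span_syz k x hx hk)

/-- The variables generating the colon ideals of the syzygies. -/
def syzVars (A : ι → Finset (Fin n)) (p : SyzIndex A) : Finset (Fin n) :=
  (A p.1).filter (· ≤ p.2.1)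

/-- Reading off coordinate `k` gives one inclusion: syzygies with smaller first index vanish there,
and those at `k` contribute `e_b` with `b < a`, so `x * e_a` lies in the ideal of these `e_b`.
Conversely, once coordinate `k` is cancelled by the syzygies `(k, b)` with `b < a`, the remainder is
a syzygy supported before `k`, hence generated by lexicographically smaller ones. -/
theorem LinQuot.linQuot_syz (h : LinQuot degC δ A g) :
    LinQuot δ (fun p : SyzIndex A => δ p.1 + 1) (syzVars A) h.syz where
  mono p q hpq := by
    rcases Sigma.Lex.le_def.1 hpq with h1 | ⟨h1, -⟩
    · have := h.mono h1.le
      dsimp only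
      omega
    · dsimp only
      rw [h1]
  homog := h.isHomog_syz
  colon := by
    rintro ⟨k, a⟩ x
    have hset : ((syzVars A ⟨k, a⟩ : Finset (Fin n)) : Set (Fin n)) =
        insert a.1 {b | b ∈ A k ∧ b < a.1} := by
      ext b
      simp only [syzVars, Finset.coe_filter, Set.mem_ofPred_eq, Set.mem_insert_iff]
      constructor
      · rintro ⟨h1, h2⟩
        rcases h2.eq_or_lt with h2 | h2
        · exact .inl h2
        · exact .inr ⟨h1, h2⟩
      · rintro (rfl | ⟨h1, h2⟩)
        · exact ⟨a.2, le_rfl⟩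
        · exact ⟨h1, h2.le⟩
    rw [hset, ← mul_e_mem_span_e (by simp)]
    constructor
    · intro hx
      have h1 : Submodule.span (Ext K n) (h.syz '' Set.Iio ⟨k, a⟩) ≤
          Submodule.comap (Finsupp.lapply k) (Ideal.span (e K '' {b | b ∈ A k ∧ b < a.1})) := by
        refine Submodule.span_le.2 ?_
        rintro _ ⟨⟨l, b⟩, hq, rfl⟩
        rw [SetLike.mem_coe, Submodule.mem_comap, Finsupp.lapply_apply]
        rcases Sigma.Lex.lt_def.1 hq with h1 | ⟨h1, h2⟩
        · rw [h.syz_of_lt ⟨l, b⟩ h1]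
          exact zero_mem _
        · obtain rfl : l = k := h1
          rw [h.syz_self ⟨l, b⟩]
          exact Ideal.subset_span ⟨b.1, ⟨b.2, h2⟩, rfl⟩
      have h2 := h1 hx
      rw [Submodule.mem_comap, Finsupp.lapply_apply, Finsupp.smul_apply, h.syz_self ⟨k, a⟩] at h2
      exact h2
    · intro hx
      obtain ⟨z, hz, hzk⟩ := h.exists_mem_span_syz k _ (fun _ hb => hb.1) hx
      have hz' : z ∈ Submodule.span (Ext K n) (h.syz '' Set.Iio ⟨k, a⟩) := by
        refine Submodule.span_mono (Set.image_mono ?_) hz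
        rintro ⟨l, b⟩ ⟨h1, h2⟩
        obtain rfl : l = k := h1
        exact Sigma.Lex.lt_def.2 (.inr ⟨rfl, h2.2⟩)
      suffices x • h.syz ⟨k, a⟩ - z ∈ Submodule.span (Ext K n) (h.syz '' Set.Iio ⟨k, a⟩) by
        simpa using add_mem this hz'
      by_cases h0 : x • h.syz ⟨k, a⟩ - z = 0
      · simp [h0]
      obtain ⟨l, hl, hl0⟩ := exists_max_ne_zero h0
      have hlk : l < k := by
        by_contra hkl
        rcases (not_lt.1 hkl).eq_or_lt with rfl | hkl
        · apply hl
          rw [Finsupp.sub_apply, Finsupp.smul_apply, h.syz_self ⟨k, a⟩, hzk, smul_eq_mul, sub_self]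
        · apply hl
          rw [Finsupp.sub_apply, Finsupp.smul_apply, h.syz_of_lt ⟨k, a⟩ hkl,
            h.apply_eq_zero_of_mem_span_syz l (fun p hp => hp.1.trans_lt hkl) hz, sub_zero,
            smul_zero]
      refine Submodule.span_mono (Set.image_mono fun p hp => ?_) (h.mem_span_syz l _ (sub_mem
        (Submodule.smul_mem _ _ (h.linearCombination_syz _)) (h.span_syz_le_ker _ hz)) hl0)
      exact Sigma.Lex.lt_def.2 (.inl (lt_of_le_of_lt hp hlk))

end VectorSpread

end

/-! ### Uniqueness of minimal presentations and the count of basis elements. -/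

noncomputable section

namespace VectorSpread

open Module

variable {K : Type*} [Field K] {n : ℕ} {B B' C : Type} {deg : B → ℤ} {deg' : B' → ℤ} {degC : C → ℤ}

theorem HomogOnBasis.compHom {f : (B →₀ Ext K n) →ₗ[Ext K n] (B' →₀ Ext K n)}
    {g : (B' →₀ Ext K n) →ₗ[Ext K n] (C →₀ Ext K n)}
    (hg : HomogOnBasis deg' degC g) (hf : HomogOnBasis deg deg' f) :
    HomogOnBasis deg degC (g ∘ₗ f) := fun b => hg.isHomog (hf b)

theorem HomogOnBasis.exists_lift {f : (B →₀ Ext K n) →ₗ[Ext K n] (C →₀ Ext K n)}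
    {g : (B' →₀ Ext K n) →ₗ[Ext K n] (C →₀ Ext K n)}
    (hf : HomogOnBasis deg degC f) (hg : HomogOnBasis deg' degC g)
    (hle : LinearMap.range f ≤ LinearMap.range g) :
    ∃ φ : (B →₀ Ext K n) →ₗ[Ext K n] (B' →₀ Ext K n),
      HomogOnBasis deg deg' φ ∧ g ∘ₗ φ = f := by
  have h1 : ∀ b, ∃ y, IsHomog deg' (deg b) y ∧ g y = f (Finsupp.single b 1) :=
    fun b => hg.exists_preimage (hf b) (hle ⟨_, rfl⟩)
  choose y hy hgy using h1
  refine ⟨Finsupp.linearCombination (Ext K n) y, fun b => by simpa using hy b, ?_⟩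
  ext b : 2
  simp [hgy]

/-- Graded Nakayama. The error `θ b - b` has coefficients of positive degree, so it involves only
basis elements of degree smaller than `deg b`, and induction on the degree applies. -/
theorem surjective_of_sub_mem_maxIdeal [Finite B] {θ : (B →₀ Ext K n) →ₗ[Ext K n] (B →₀ Ext K n)}
    (hθ : HomogOnBasis deg deg θ)
    (hm : ∀ b c, (θ (Finsupp.single b 1) - Finsupp.single b 1 : B →₀ Ext K n) c ∈ maxIdeal K n) :
    Function.Surjective θ := by
  have := Fintype.ofFinite B
  rw [← LinearMap.range_eq_top, eq_top_iff]
  have hwf : WellFounded (fun b c : B => deg b < deg c) := by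
    have : IsTrans B (fun b c : B => deg b < deg c) := ⟨fun _ _ _ => lt_trans⟩
    have : Std.Irrefl (fun b c : B => deg b < deg c) := ⟨fun _ => lt_irrefl _⟩
    exact Finite.wellFounded_of_trans_of_irrefl _
  have key : ∀ b, Finsupp.single b (1 : Ext K n) ∈ LinearMap.range θ := by
    intro b
    induction b using hwf.induction with
    | _ b ih =>
      set N := θ (Finsupp.single b 1) - Finsupp.single b 1 with hN
      have hNh : IsHomog deg (deg b) N := (hθ b).sub (isHomog_single b)
      have hNr : N ∈ LinearMap.range θ := by
        rw [← Finsupp.sum_single N, Finsupp.sum]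
        refine Submodule.sum_mem _ fun c hc => ?_
        have h1 : Finsupp.single c (N c) = N c • Finsupp.single c 1 := by simp
        rw [h1]
        refine Submodule.smul_mem _ _ (ih c ?_)
        have h0 : N c ≠ 0 := by simpa using hc
        obtain ⟨p, hp, hmem⟩ := hNh c h0
        rcases Nat.eq_zero_or_pos p with rfl | hp0
        · exact absurd (eq_zero_of_mem_maxIdeal hmem (hm b c)) h0
        · omega
      have h2 : Finsupp.single b 1 = θ (Finsupp.single b 1) - N := by simp [hN]
      rw [h2]
      exact sub_mem ⟨_, rfl⟩ hNr
  rintro x -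
  rw [← Finsupp.sum_single x, Finsupp.sum]
  refine Submodule.sum_mem _ fun c _ => ?_
  have h1 : Finsupp.single c (x c) = x c • Finsupp.single c 1 := by simp
  rw [h1]
  exact Submodule.smul_mem _ _ (key c)

/-- Both sides are finite-dimensional over `K`, where the two properties of an endomorphism agree.
-/
theorem injective_of_surjective_end [Finite B]
    {θ : (B →₀ Ext K n) →ₗ[Ext K n] (B →₀ Ext K n)} (h : Function.Surjective θ) :
    Function.Injective θ :=
  (LinearMap.injective_iff_surjective (f := θ.restrictScalars K)).2 h

/-- The part of degree `j` of the reduction modulo the maximal ideal of a homogeneous map. -/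
def residueMatrix (deg : B → ℤ) (deg' : B' → ℤ)
    (φ : (B →₀ Ext K n) →ₗ[Ext K n] (B' →₀ Ext K n)) (j : ℤ) :
    Matrix {b // deg b = j} {b // deg' b = j} K :=
  fun b c => residue (φ (Finsupp.single b.1 1) c.1)

/-- The residue map is multiplicative, and an entry of `φ b` at a basis element of degree other than
`j` has positive degree, hence residue zero. So the degree `j` block multiplies by itself. Rows
index the source, which is why `φ` stands on the left. -/
theorem residueMatrix_mul [Finite B] [Fintype B'] {j : ℤ} [Fintype {b // deg' b = j}]
    [DecidableEq {b // deg b = j}]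
    {φ : (B →₀ Ext K n) →ₗ[Ext K n] (B' →₀ Ext K n)}
    {ψ : (B' →₀ Ext K n) →ₗ[Ext K n] (B →₀ Ext K n)} (hφ : HomogOnBasis deg deg' φ)
    (hm : ∀ b c, (ψ (φ (Finsupp.single b 1)) - Finsupp.single b 1 : B →₀ Ext K n) c ∈ maxIdeal K n) :
    residueMatrix deg deg' φ j * residueMatrix deg' deg ψ j = 1 := by
  classical
  ext b c
  have h1 : ψ (φ (Finsupp.single b.1 1)) c.1 =
      ∑ a : B', φ (Finsupp.single b.1 1) a * ψ (Finsupp.single a 1) c.1 := by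
    conv_lhs => rw [← Finsupp.univ_sum_single (φ (Finsupp.single b.1 1)), map_sum,
      Finsupp.finsetSum_apply]
    refine Finset.sum_congr rfl fun a _ => ?_
    have h1 : ∀ x : Ext K n, Finsupp.single a x = x • Finsupp.single a 1 := by simp
    rw [h1, map_smul, Finsupp.smul_apply, smul_eq_mul]
  have h2 := residue_eq_zero (hm b.1 c.1)
  rw [Finsupp.sub_apply, map_sub, sub_eq_zero, h1, map_sum] at h2
  rw [Matrix.mul_apply, Matrix.one_apply]
  have h3 : residue (Finsupp.single b.1 (1 : Ext K n) c.1) = if b = c then (1 : K) else 0 := by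
    rw [Finsupp.single_apply]
    by_cases h : b = c
    · simp [h]
    · rw [if_neg h, if_neg (fun h' => h (Subtype.ext h')), map_zero]
  rw [← h3, ← h2]
  have h4 : ∀ a : B', ¬ deg' a = j →
      residue (φ (Finsupp.single b.1 1) a * ψ (Finsupp.single a 1) c.1) = 0 := by
    intro a ha
    rw [map_mul]
    by_cases h0 : φ (Finsupp.single b.1 1) a = 0
    · simp [h0]
    · obtain ⟨p, hp, hmem⟩ := hφ b.1 a h0
      have hp0 : p ≠ 0 := by
        rintro rfl
        exact ha (by simpa [b.2] using hp)
      rw [residue_eq_zero (mem_maxIdeal_of_mem hp0 hmem), zero_mul]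
  rw [← Finset.sum_filter_of_ne (p := fun a => deg' a = j)
    (fun a _ hne => by by_contra h; exact hne (h4 a h)),
    ← Finset.sum_subtype_eq_sum_filter]
  refine Finset.sum_bij (fun a _ => a) ?_ ?_ ?_ ?_
  · simp
  · simp
  · simp
  · intro a _
    rw [map_mul]
    rfl

/-- Two minimal homogeneous presentations of the same submodule are isomorphic. -/
theorem exists_iso_of_minimal [Finite B] [Finite B']
    {f : (B →₀ Ext K n) →ₗ[Ext K n] (C →₀ Ext K n)}
    {g : (B' →₀ Ext K n) →ₗ[Ext K n] (C →₀ Ext K n)}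
    (hf : HomogOnBasis deg degC f) (hg : HomogOnBasis deg' degC g)
    (hfg : LinearMap.range f = LinearMap.range g)
    (hfm : ∀ x ∈ LinearMap.ker f, ∀ b, x b ∈ maxIdeal K n)
    (hgm : ∀ x ∈ LinearMap.ker g, ∀ b, x b ∈ maxIdeal K n) :
    (∃ φ : (B →₀ Ext K n) ≃ₗ[Ext K n] (B' →₀ Ext K n),
      HomogOnBasis deg deg' φ.toLinearMap ∧ g ∘ₗ φ.toLinearMap = f) ∧
    ∀ j, Nat.card {b // deg b = j} = Nat.card {b // deg' b = j} := by
  classical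
  have := Fintype.ofFinite B
  have := Fintype.ofFinite B'
  obtain ⟨φ, hφ, hφg⟩ := hf.exists_lift hg hfg.le
  obtain ⟨ψ, hψ, hψf⟩ := hg.exists_lift hf hfg.ge
  have e1 : ∀ x, g (φ x) = f x := fun x => LinearMap.congr_fun hφg x
  have e2 : ∀ x, f (ψ x) = g x := fun x => LinearMap.congr_fun hψf x
  -- `ψ (φ b) - b` lies in the kernel of `f`, hence has coefficients in the maximal ideal by
  -- minimality.
  have m1 : ∀ b c, (ψ (φ (Finsupp.single b 1)) - Finsupp.single b 1 : B →₀ Ext K n) c ∈ maxIdeal K n :=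
    fun b c => hfm _ (by simp [e1, e2]) c
  have m2 : ∀ b c, (φ (ψ (Finsupp.single b 1)) - Finsupp.single b 1 : B' →₀ Ext K n) c ∈ maxIdeal K n :=
    fun b c => hgm _ (by simp [e1, e2]) c
  have s1 : Function.Surjective (ψ ∘ₗ φ) := surjective_of_sub_mem_maxIdeal (hψ.compHom hφ) m1
  have s2 : Function.Surjective (φ ∘ₗ ψ) := surjective_of_sub_mem_maxIdeal (hφ.compHom hψ) m2
  have i1 := injective_of_surjective_end s1
  rw [LinearMap.coe_comp] at i1 s2
  refine ⟨⟨LinearEquiv.ofBijective φ ⟨i1.of_comp, s2.of_comp⟩, hφ, hφg⟩, fun j => ?_⟩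
  rw [Nat.card_eq_fintype_card, Nat.card_eq_fintype_card]
  -- The two residue matrices are mutually inverse over the field `K`, so they are square.
  exact Matrix.square_of_invertible _ _ (residueMatrix_mul (j := j) hφ m1)
    (residueMatrix_mul (j := j) hψ m2)

theorem LinQuot.map {ι : Type} [LinearOrder ι] {δ : ι → ℤ}
    {A : ι → Finset (Fin n)} {g : ι → (B →₀ Ext K n)} (h : LinQuot deg δ A g)
    (φ : (B →₀ Ext K n) ≃ₗ[Ext K n] (B' →₀ Ext K n)) (hφ : HomogOnBasis deg deg' φ.toLinearMap) :
    LinQuot deg' δ A (fun k => φ (g k)) where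
  mono := h.mono
  homog k := hφ.isHomog (h.homog k)
  colon k x := by
    rw [← h.colon k x, ← map_smul]
    have : (fun k => φ (g k)) '' Set.Iio k = φ.toLinearMap '' (g '' Set.Iio k) := by
      rw [Set.image_image]; rfl
    rw [this, Submodule.span_image]
    exact ⟨fun ⟨y, hy, hxy⟩ => φ.injective hxy ▸ hy, Submodule.mem_map_of_mem⟩

/-- The filtered sets have sizes `1, …, |A|`, so this is the hockey-stick identity. A new maximum
leaves the earlier terms unchanged and adds exactly the Pascal term. -/
theorem sum_multichoose_card_filter_le (A : Finset (Fin n)) (i : ℕ) :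
    ∑ a ∈ A, (A.filter (· ≤ a)).card.multichoose i = A.card.multichoose (i + 1) := by
  induction A using Finset.induction_on_max with
  | empty => simp
  | insert a s hs ih =>
    have ha : a ∉ s := fun h => lt_irrefl _ (hs a h)
    rw [Finset.sum_insert ha, Finset.card_insert_of_notMem ha, Nat.multichoose_succ_succ, ← ih,
      add_comm]
    congr 1
    · refine Finset.sum_congr rfl fun b hb => ?_
      rw [Finset.filter_insert, if_neg (not_le.2 (hs b hb))]
    · rw [Finset.filter_true_of_mem, Finset.card_insert_of_notMem ha]
      intro b hb
      rcases Finset.mem_insert.1 hb with rfl | hb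
      · exact le_rfl
      · exact (hs b hb).le

theorem sum_syzIndex {ι : Type} [Fintype ι] [LinearOrder ι] (δ : ι → ℤ) (A : ι → Finset (Fin n))
    (i : ℕ) (j : ℤ) :
    ∑ p : SyzIndex A with δ p.1 + 1 = j + 1, (syzVars A p).card.multichoose i =
      ∑ k with δ k = j, (A k).card.multichoose (i + 1) := by
  rw [Finset.sum_filter, Finset.sum_filter]
  have h1 : ∀ F : SyzIndex A → ℕ, ∑ p, F p = ∑ k, ∑ a : A k, F ⟨k, a⟩ := by
    intro F
    rw [← Fintype.sum_sigma' (fun k (a : A k) => F ⟨k, a⟩)]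
    exact Fintype.sum_equiv ofLex _ _ fun _ => rfl
  rw [h1]
  refine Finset.sum_congr rfl fun k _ => ?_
  by_cases hk : δ k = j
  · simp only [hk, if_true, syzVars]
    rw [← sum_multichoose_card_filter_le, ← Finset.sum_coe_sort (A k)]
  · simp [hk]

theorem LinQuot.ker_le_maxIdeal {ι : Type} [LinearOrder ι] [Finite ι] {δ : ι → ℤ}
    {A : ι → Finset (Fin n)} {g : ι → (C →₀ Ext K n)} (h : LinQuot degC δ A g) :
    ∀ x ∈ LinearMap.ker (Finsupp.linearCombination (Ext K n) g), ∀ b, x b ∈ maxIdeal K n := by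
  intro x hx b
  rw [← h.span_syz] at hx
  have : Submodule.span (Ext K n) (Set.range h.syz) ≤
      Submodule.comap (Finsupp.lapply b) (maxIdeal K n) := by
    refine Submodule.span_le.2 ?_
    rintro _ ⟨p, rfl⟩
    exact h.syz_mem p b
  exact this hx

/-- The target module, the sequence and the resolution all vary in the induction: the next step
drops `B 0`, takes `d 0` as augmentation, and uses the syzygies transported to `B 0` by the
isomorphism of minimal presentations. -/
theorem LinQuot.card_basis (i : ℕ) : ∀ (j : ℤ) {C : Type} {degC : C → ℤ} {ι : Type} [LinearOrder ι]
    [Fintype ι] {δ : ι → ℤ} {A : ι → Finset (Fin n)} {g : ι → (C →₀ Ext K n)}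
    (_ : LinQuot degC δ A g) (B : ℕ → Type) (_ : ∀ i, Finite (B i)) (deg : ∀ i, B i → ℤ)
    (d : ∀ i, (B (i + 1) →₀ Ext K n) →ₗ[Ext K n] (B i →₀ Ext K n))
    (ε : (B 0 →₀ Ext K n) →ₗ[Ext K n] (C →₀ Ext K n))
    (_ : ∀ i, HomogOnBasis (deg (i + 1)) (deg i) (d i)) (_ : HomogOnBasis (deg 0) degC ε)
    (_ : LinearMap.range ε = Submodule.span (Ext K n) (Set.range g))
    (_ : LinearMap.range (d 0) = LinearMap.ker ε)
    (_ : ∀ i, LinearMap.range (d (i + 1)) = LinearMap.ker (d i))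
    (_ : ∀ i x b, d i x b ∈ maxIdeal K n),
    Nat.card {b : B i // deg i b = i + j} = ∑ k with δ k = j, (A k).card.multichoose i := by
  induction i with
  | zero =>
    intro j C degC ι _ _ δ A g h B hB deg d ε hd hε hr h0 hs hm
    have := (exists_iso_of_minimal h.homogOnBasis hε
      (by rw [hr, Finsupp.range_linearCombination]) h.ker_le_maxIdeal (by
        rw [← h0]
        rintro _ ⟨x, rfl⟩
        exact hm 0 x)).2 j
    simp only [Nat.cast_zero, zero_add, Nat.multichoose_zero_right, Finset.sum_const, smul_eq_mul,
      mul_one]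
    rw [← this, Nat.card_eq_fintype_card, Fintype.card_subtype]
  | succ i ih =>
    intro j C degC ι _ _ δ A g h B hB deg d ε hd hε hr h0 hs hm
    obtain ⟨φ, hφ, hφε⟩ := (exists_iso_of_minimal h.homogOnBasis hε
      (by rw [hr, Finsupp.range_linearCombination]) h.ker_le_maxIdeal (by
        rw [← h0]
        rintro _ ⟨x, rfl⟩
        exact hm 0 x)).1
    have := ih (j + 1) (h.linQuot_syz.map φ hφ) (fun i => B (i + 1)) (fun i => hB _)
      (fun i => deg (i + 1)) (fun i => d (i + 1)) (d 0) (fun i => hd _) (hd 0) ?_ (hs 0)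
      (fun i => hs _) (fun i => hm _)
    · rw [sum_syzIndex] at this
      rw [← this]
      have h2 : ((i + 1 : ℕ) : ℤ) + j = i + (j + 1) := by push_cast; ring
      rw [h2]
    -- As `ε ∘ φ` is the presentation by `g`, `φ` maps the syzygy module of `g` onto `ker ε`.
    · have h1 : Set.range (fun k => φ (h.syz k)) = φ.toLinearMap '' Set.range h.syz := by
        rw [← Set.range_comp]; rfl
      rw [h0, h1, Submodule.span_image, h.span_syz, ← hφε]
      ext x
      simp only [Submodule.mem_map, LinearMap.mem_ker, LinearMap.coe_comp, Function.comp_apply]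
      constructor
      · intro hx
        exact ⟨φ.symm x, by simpa using hx, by simp⟩
      · rintro ⟨y, hy, rfl⟩
        exact hy

end VectorSpread

end

/-! ### The resolution obtained by iterating syzygies. -/

noncomputable section

namespace VectorSpread

open Module

variable {K : Type*} [Field K] {n : ℕ}

variable (K n) in
/-- A sequence with linear quotients, bundled with its ambient graded free module. -/
structure LinQuotSeq where
  C : Type
  degC : C → ℤ
  ι : Type
  [linearOrder : LinearOrder ι]
  [fintype : Fintype ι]
  δ : ι → ℤ
  A : ι → Finset (Fin n)
  g : ι → (C →₀ Ext K n)
  linQuot : LinQuot degC δ A g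

attribute [instance] LinQuotSeq.linearOrder LinQuotSeq.fintype

/-- The sequence of the chosen syzygies. -/
def LinQuotSeq.next (S : LinQuotSeq K n) : LinQuotSeq K n where
  C := S.ι
  degC := S.δ
  ι := SyzIndex S.A
  δ := fun p => S.δ p.1 + 1
  A := syzVars S.A
  g := S.linQuot.syz
  linQuot := S.linQuot.linQuot_syz

/-- The iterated syzygies. -/
def LinQuotSeq.iter (S : LinQuotSeq K n) : ℕ → LinQuotSeq K n
  | 0 => S
  | i + 1 => (S.iter i).next

/-- The linear map sending the basis to the elements of the sequence. -/
def LinQuotSeq.lin (S : LinQuotSeq K n) : (S.ι →₀ Ext K n) →ₗ[Ext K n] (S.C →₀ Ext K n) :=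
  Finsupp.linearCombination (Ext K n) S.g

theorem LinQuotSeq.range_next (S : LinQuotSeq K n) :
    LinearMap.range S.next.lin = LinearMap.ker S.lin :=
  (Finsupp.range_linearCombination (Ext K n)).trans S.linQuot.span_syz

theorem LinQuotSeq.next_mem_maxIdeal (S : LinQuotSeq K n) (x : S.next.ι →₀ Ext K n) (b : S.ι) :
    S.next.lin x b ∈ maxIdeal K n := by
  refine S.linQuot.ker_le_maxIdeal (S.next.lin x) ?_ b
  have : S.next.lin x ∈ LinearMap.ker S.lin := by
    rw [← S.range_next]
    exact ⟨x, rfl⟩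
  exact this

/-- The inclusion of `E` as the graded free module on one generator of degree `0`. -/
abbrev toFree : Ext K n →ₗ[Ext K n] (Unit →₀ Ext K n) := Finsupp.lsingle ()

theorem toFree_injective : Function.Injective (toFree (K := K) (n := n)) :=
  Finsupp.single_injective ()

theorem isHomog_toFree {k : ℤ} {x : Ext K n} :
    IsHomog (fun _ : Unit => 0) k (toFree x) ↔
      (x ≠ 0 → ∃ p : ℕ, (p : ℤ) = k ∧ x ∈ ⋀[K]^p (Fin n → K)) := by
  simp [IsHomog]

theorem linQuot_toFree {ι : Type} [LinearOrder ι] {δ : ι → ℕ} (hδ : Monotone δ)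
    {A : ι → Finset (Fin n)} {g : ι → Ext K n} (hg : ∀ k, g k ∈ ⋀[K]^(δ k) (Fin n → K))
    (hA : ∀ k x, x * g k ∈ Ideal.span (g '' Set.Iio k) ↔
      x ∈ Ideal.span (e K '' (A k : Set (Fin n)))) :
    LinQuot (fun _ : Unit => 0) (fun k => (δ k : ℤ)) A (fun k => toFree (g k)) where
  mono k l hkl := Nat.cast_le.2 (hδ hkl)
  homog k := isHomog_toFree.2 fun _ => ⟨δ k, rfl, hg k⟩
  colon k x := by
    rw [← hA, ← map_smul, ← smul_eq_mul]
    have : (fun k => toFree (g k)) '' Set.Iio k = toFree '' (g '' Set.Iio k) := by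
      rw [Set.image_image]
    rw [this, Submodule.span_image]
    exact ⟨fun ⟨y, hy, hxy⟩ => toFree_injective hxy ▸ hy, Submodule.mem_map_of_mem⟩

theorem range_linearCombination_toFree {ι : Type} (g : ι → Ext K n) :
    Submodule.span (Ext K n) (Set.range fun k => toFree (g k)) =
      Submodule.map toFree (Ideal.span (Set.range g)) := by
  have : Set.range (fun k => toFree (g k)) = toFree '' Set.range g := by
    rw [← Set.range_comp]; rfl
  rw [this, Submodule.span_image]

theorem linearCombination_toFree {ι : Type} (g : ι → Ext K n) :
    Finsupp.linearCombination (Ext K n) (fun k => toFree (g k)) =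
      toFree ∘ₗ Finsupp.linearCombination (Ext K n) g := by
  ext k : 2
  simp

section

variable {ι : Type} [LinearOrder ι] [Fintype ι] {δ : ι → ℕ} {A : ι → Finset (Fin n)}
  {g : ι → Ext K n}

theorem nonempty_minGradedFreeRes (hδ : Monotone δ) (hg : ∀ k, g k ∈ ⋀[K]^(δ k) (Fin n → K))
    (hA : ∀ k x, x * g k ∈ Ideal.span (g '' Set.Iio k) ↔
      x ∈ Ideal.span (e K '' (A k : Set (Fin n)))) :
    Nonempty (MinGradedFreeRes (Ideal.span (Set.range g))) := by
  let S : LinQuotSeq K n := ⟨Unit, _, ι, _, _, _, linQuot_toFree hδ hg hA⟩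
  have hS : S.lin = toFree ∘ₗ Finsupp.linearCombination (Ext K n) g :=
    linearCombination_toFree g
  refine ⟨{
    B := fun i => (S.iter i).ι
    finite_B := fun i => inferInstance
    deg := fun i => (S.iter i).δ
    d := fun i => (S.iter (i + 1)).lin
    ε := Finsupp.linearCombination (Ext K n) g
    d_homog := fun i k x hx => (S.iter (i + 1)).linQuot.homogOnBasis.isHomog hx
    ε_homog := ?_
    range_ε := Finsupp.range_linearCombination (Ext K n)
    exact_zero := ?_
    exact_succ := fun i => (S.iter (i + 1)).range_next
    minimal := fun i x b => (S.iter i).next_mem_maxIdeal x b }⟩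
  · intro k x hx h0
    have h1 : IsHomog (fun _ : Unit => 0) k (S.lin x) := S.linQuot.homogOnBasis.isHomog hx
    rw [hS] at h1
    exact isHomog_toFree.1 h1 h0
  · refine S.range_next.trans ?_
    rw [hS, LinearMap.ker_comp_of_ker_eq_bot _ (LinearMap.ker_eq_bot.2 toFree_injective)]
    rfl

theorem betti_eq (hδ : Monotone δ) (hg : ∀ k, g k ∈ ⋀[K]^(δ k) (Fin n → K))
    (hA : ∀ k x, x * g k ∈ Ideal.span (g '' Set.Iio k) ↔
      x ∈ Ideal.span (e K '' (A k : Set (Fin n))))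
    (F : MinGradedFreeRes (Ideal.span (Set.range g))) (i j : ℕ) :
    F.betti i ((i : ℤ) + (j : ℤ)) = ∑ k with δ k = j, (A k).card.multichoose i := by
  have h := LinQuot.card_basis i j (linQuot_toFree hδ hg hA) F.B F.finite_B F.deg F.d
    (toFree ∘ₗ F.ε) (fun i b => F.d_homog i _ _ (isHomog_single b))
    (fun b => isHomog_toFree.2 fun h0 => F.ε_homog _ _ (isHomog_single b) h0)
    (by rw [LinearMap.range_comp, F.range_ε, range_linearCombination_toFree])
    (by rw [F.exact_zero,
      LinearMap.ker_comp_of_ker_eq_bot _ (LinearMap.ker_eq_bot.2 toFree_injective)])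
    F.exact_succ F.minimal
  rw [MinGradedFreeRes.betti, h]
  simp only [Nat.cast_inj]

end

end VectorSpread

end

/-! ### Combinatorics of spread monomials and their colon ideals. -/

noncomputable section

namespace VectorSpread

variable {K : Type*} [Field K] {d n : ℕ} {t : Fin (d - 1) → ℕ}

/-- The increasing sequences that enumerate the supports of `t`-spread monomials. -/
structure IsSpreadSeq (t : Fin (d - 1) → ℕ) {s : ℕ} (f : Fin s → Fin n) : Prop where
  strictMono : StrictMono f
  pos : 0 < s
  le : s ≤ d
  spread : ∀ (h : Fin (d - 1)) (hh : (h : ℕ) + 1 < s),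
    (f ⟨h, Nat.lt_of_succ_lt hh⟩ : ℕ) + t h ≤ (f ⟨(h : ℕ) + 1, hh⟩ : ℕ)

theorem IsSpread.isSpreadSeq {μ : Finset (Fin n)} (hμ : IsSpread t μ) {s : ℕ} (hs : μ.card = s) :
    IsSpreadSeq t (μ.orderEmbOfFin hs) := by
  subst hs
  exact ⟨(μ.orderEmbOfFin rfl).strictMono, hμ.1.card_pos, hμ.2.1, hμ.2.2⟩

theorem card_image_of_strictMono {s : ℕ} {f : Fin s → Fin n} (hf : StrictMono f) :
    (Finset.univ.image f).card = s := by
  rw [Finset.card_image_of_injective _ hf.injective, Finset.card_univ, Fintype.card_fin]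

theorem IsSpreadSeq.isSpread {s : ℕ} {f : Fin s → Fin n} (hf : IsSpreadSeq t f) :
    IsSpread t (Finset.univ.image f) := by
  have hc := card_image_of_strictMono hf.strictMono
  have hu : f = (Finset.univ.image f).orderEmbOfFin hc :=
    Finset.orderEmbOfFin_unique hc (by simp) hf.strictMono
  have key : ∀ (μ : Finset (Fin n)) (hc : μ.card = s), IsSpreadSeq t (μ.orderEmbOfFin hc) →
      IsSpread t μ := by
    intro μ hc h
    subst hc
    exact ⟨Finset.card_pos.1 h.pos, h.le, h.spread⟩
  exact key _ hc (hu ▸ hf)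

theorem image_orderEmbOfFin (μ : Finset (Fin n)) {s : ℕ} (hs : μ.card = s) :
    Finset.univ.image (μ.orderEmbOfFin hs) = μ := by
  simp

theorem exists_orderEmbOfFin_eq {μ : Finset (Fin n)} {s : ℕ} (hs : μ.card = s) {a : Fin n}
    (ha : a ∈ μ) : ∃ p, μ.orderEmbOfFin hs p = a := by
  have : a ∈ Set.range (μ.orderEmbOfFin hs) := by
    rw [Finset.range_orderEmbOfFin]; exact ha
  exact this

theorem lt_maxSupp {μ : Finset (Fin n)} {a : ℕ} : a < maxSupp μ ↔ ∃ b ∈ μ, a ≤ (b : ℕ) := by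
  simp [maxSupp, Finset.lt_sup_iff]

/-! ### Lowering one entry of a spread sequence -/

section move

variable {s : ℕ} {f : Fin s → Fin n} {p : Fin s} {a : Fin n}

/-- Lowering an entry widens the gap on its right, so only the gap on its left needs a hypothesis.
-/
theorem IsSpreadSeq.update (hf : IsSpreadSeq t f) (ha : a < f p) (hlt : ∀ q < p, f q < a)
    (hsp : ∀ (h : Fin (d - 1)) (hh : (h : ℕ) + 1 = p),
      (f ⟨h, by have := p.2; omega⟩ : ℕ) + t h ≤ a) :
    IsSpreadSeq t (Function.update f p a) where
  strictMono q r hqr := by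
    by_cases hq : q = p
    · subst hq
      rw [Function.update_self, Function.update_of_ne hqr.ne']
      exact ha.trans (hf.strictMono hqr)
    · rw [Function.update_of_ne hq]
      by_cases hr : r = p
      · subst hr
        rw [Function.update_self]
        exact hlt q hqr
      · rw [Function.update_of_ne hr]
        exact hf.strictMono hqr
  pos := hf.pos
  le := hf.le
  spread h hh := by
    have h0 := hf.spread h hh
    by_cases hr : (⟨(h : ℕ) + 1, hh⟩ : Fin s) = p
    · have hq : (⟨h, Nat.lt_of_succ_lt hh⟩ : Fin s) ≠ p := by
        rw [← hr]; intro h'; simp at h'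
      have h1 := hsp h (by rw [← hr])
      rw [hr, Function.update_self, Function.update_of_ne hq]
      exact h1
    · rw [Function.update_of_ne hr]
      by_cases hq : (⟨h, Nat.lt_of_succ_lt hh⟩ : Fin s) = p
      · rw [hq, Function.update_self]
        rw [hq] at h0
        have : (a : ℕ) < f p := ha
        omega
      · rw [Function.update_of_ne hq]
        exact h0

theorem notMem_image_of_lt (hf : StrictMono f) (ha : a < f p) (hlt : ∀ q < p, f q < a) :
    a ∉ Finset.univ.image f := by
  simp only [Finset.mem_image, Finset.mem_univ, true_and, not_exists]
  rintro q rfl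
  rcases lt_or_ge q p with h | h
  · exact lt_irrefl _ (hlt q h)
  · exact (hf.monotone h).not_gt ha

theorem image_update (hf : StrictMono f) :
    Finset.univ.image (Function.update f p a) = insert a ((Finset.univ.image f).erase (f p)) := by
  ext b
  simp only [Finset.mem_image, Finset.mem_univ, true_and, Finset.mem_insert, Finset.mem_erase]
  constructor
  · rintro ⟨q, rfl⟩
    by_cases hq : q = p
    · subst hq; simp
    · rw [Function.update_of_ne hq]
      exact .inr ⟨fun h => hq (hf.injective h), q, rfl⟩
  · rintro (rfl | ⟨h, q, rfl⟩)
    · exact ⟨p, Function.update_self ..⟩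
    · exact ⟨q, Function.update_of_ne (fun h' => h (by rw [h'])) _ _⟩

theorem IsSpreadStronglyStable.update_mem {I : Ideal (Ext K n)} (hI : IsSpreadStronglyStable t I)
    (hf : IsSpreadSeq t f) (hm : monomial K (Finset.univ.image f) ∈ I)
    (ha : a < f p) (hlt : ∀ q < p, f q < a)
    (hsp : ∀ (h : Fin (d - 1)) (hh : (h : ℕ) + 1 = p),
      (f ⟨h, by have := p.2; omega⟩ : ℕ) + t h ≤ a) :
    monomial K (Finset.univ.image (Function.update f p a)) ∈ I := by
  have hn := notMem_image_of_lt hf.strictMono ha hlt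
  have h1 := hI.2 _ hf.isSpread hm (f p) (by simp) a ha hn
    (by rw [← image_update hf.strictMono]; exact (hf.update ha hlt hsp).isSpread)
  rw [image_update hf.strictMono]
  have hd : Disjoint {a} ((Finset.univ.image f).erase (f p)) := by
    rw [Finset.disjoint_singleton_left]
    exact fun h => hn (Finset.mem_of_mem_erase h)
  rw [← monomial_singleton, monomial_mul, if_pos hd] at h1
  have h2 := I.smul_of_tower_mem (sign K {a} ((Finset.univ.image f).erase (f p)))⁻¹ h1
  rwa [smul_smul, inv_mul_cancel₀ (sign_ne_zero _ _), one_smul, ← Finset.insert_eq] at h2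

end move

/-! ### Minimal generators -/

/-- `e_μ` is a minimal monomial generator of `I`. -/
def IsMinGen (I : Ideal (Ext K n)) (μ : Finset (Fin n)) : Prop :=
  monomial K μ ∈ I ∧ ∀ ν : Finset (Fin n), ν ⊂ μ → monomial K ν ∉ I

theorem exists_isMinGen_subset {I : Ideal (Ext K n)} (μ : Finset (Fin n)) (h : monomial K μ ∈ I) :
    ∃ ν ⊆ μ, IsMinGen I ν := by
  induction μ using Finset.strongInduction with
  | H μ ih =>
    by_cases h' : ∃ ν ⊂ μ, monomial K ν ∈ I
    · obtain ⟨ν, hν, hνI⟩ := h'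
      obtain ⟨ρ, hρ, hρI⟩ := ih ν hν hνI
      exact ⟨ρ, hρ.trans hν.subset, hρI⟩
    · exact ⟨μ, subset_rfl, h, fun ν hν hνI => h' ⟨ν, hν, hνI⟩⟩

theorem IsSpreadIdeal.isSpread_of_isMinGen {I : Ideal (Ext K n)} (hI : IsSpreadIdeal t I)
    {μ : Finset (Fin n)} (hμ : IsMinGen I μ) : IsSpread t μ := by
  obtain ⟨S, hS, rfl⟩ := hI
  obtain ⟨ν, hν, hνμ⟩ := monomial_mem_span_monomial.1 hμ.1
  rcases hνμ.eq_or_ssubset with rfl | h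
  · exact hS _ hν
  · exact (hμ.2 ν h (Ideal.subset_span ⟨ν, hν, rfl⟩)).elim

theorem IsSpreadIdeal.span_isMinGen {I : Ideal (Ext K n)} (hI : IsSpreadIdeal t I) :
    Ideal.span (monomial K '' {μ | IsMinGen I μ}) = I := by
  refine le_antisymm (Ideal.span_le.2 ?_) ?_
  · rintro _ ⟨μ, hμ, rfl⟩
    exact hμ.1
  · obtain ⟨S, hS, hIS⟩ := hI
    conv_lhs => rw [hIS]
    refine Ideal.span_le.2 ?_
    rintro _ ⟨μ, hμ, rfl⟩
    have : monomial K μ ∈ I := by rw [hIS]; exact Ideal.subset_span ⟨μ, hμ, rfl⟩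
    obtain ⟨ν, hν, hνI⟩ := exists_isMinGen_subset μ this
    exact monomial_mem_span_monomial.2 ⟨ν, hνI, hν⟩

/-- The weight used to order monomials of the same degree. -/
def weight (μ : Finset (Fin n)) : ℕ := ∑ i ∈ μ, 2 ^ (i : ℕ)

/-- Uniqueness of binary expansions. -/
theorem weight_injective : Function.Injective (weight : Finset (Fin n) → ℕ) := by
  intro μ ν h
  have h1 : ∀ ρ : Finset (Fin n), weight ρ = ∑ i ∈ ρ.map Fin.valEmbedding, 2 ^ i := by
    intro ρ; simp [weight]
  rw [h1, h1] at h
  exact Finset.map_injective _ (Finset.geomSum_injective le_rfl h)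

/-- `e_ν` precedes `e_μ`. -/
def Precedes (ν μ : Finset (Fin n)) : Prop :=
  ν.card < μ.card ∨ ν.card = μ.card ∧ weight ν < weight μ

theorem weight_image {s : ℕ} {f : Fin s → Fin n} (hf : StrictMono f) :
    weight (Finset.univ.image f) = ∑ p, 2 ^ (f p : ℕ) := by
  rw [weight, Finset.sum_image (fun _ _ _ _ h => hf.injective h)]

/-! ### The colon ideals -/

/-- The indices of the variables generating the colon ideal of `e_μ`. -/
def colonVars (t : Fin (d - 1) → ℕ) (μ : Finset (Fin n)) : Finset (Fin n) :=
  Finset.univ.filter fun a => (a : ℕ) < maxSupp μ ∧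
    ∀ (h : Fin (d - 1)) (hh : (h : ℕ) + 1 < μ.card),
      (μ.orderEmbOfFin rfl ⟨h, Nat.lt_of_succ_lt hh⟩ : ℕ) < a →
        (μ.orderEmbOfFin rfl ⟨h, Nat.lt_of_succ_lt hh⟩ : ℕ) + t h ≤ a

theorem mem_colonVars {μ : Finset (Fin n)} {a : Fin n} :
    a ∈ colonVars t μ ↔ (a : ℕ) < maxSupp μ ∧
      ∀ (h : Fin (d - 1)) (hh : (h : ℕ) + 1 < μ.card),
        (μ.orderEmbOfFin rfl ⟨h, Nat.lt_of_succ_lt hh⟩ : ℕ) < a →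
          (μ.orderEmbOfFin rfl ⟨h, Nat.lt_of_succ_lt hh⟩ : ℕ) + t h ≤ a := by
  simp [colonVars]

theorem IsSpread.subset_colonVars {μ : Finset (Fin n)} (hμ : IsSpread t μ) :
    μ ⊆ colonVars t μ := by
  intro a ha
  refine mem_colonVars.2 ⟨lt_maxSupp.2 ⟨a, ha, le_rfl⟩, fun h hh hlt => ?_⟩
  obtain ⟨p, rfl⟩ := exists_orderEmbOfFin_eq rfl ha
  refine (hμ.2.2 h hh).trans ?_
  have h1 : (⟨h, Nat.lt_of_succ_lt hh⟩ : Fin μ.card) < p := (μ.orderEmbOfFin rfl).lt_iff_lt.1 hlt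
  have h2 : (⟨(h : ℕ) + 1, hh⟩ : Fin μ.card) ≤ p := by
    rw [Fin.lt_def] at h1; rw [Fin.le_def]; exact h1
  exact (μ.orderEmbOfFin rfl).monotone h2

/-- Replace by `a` the smallest entry of `μ` above `a`. The gap condition in `colonVars` keeps the
result spread, so it lies in `I`; its weight is smaller than that of `μ`, and any minimal generator
dividing it precedes `μ`. -/
theorem IsSpreadStronglyStable.exists_precedes {I : Ideal (Ext K n)}
    (hI : IsSpreadStronglyStable t I) {μ : Finset (Fin n)} (hμ : IsMinGen I μ) {a : Fin n}
    (ha : a ∈ colonVars t μ) (haμ : a ∉ μ) :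
    ∃ ν, IsMinGen I ν ∧ Precedes ν μ ∧ ν ⊆ insert a μ := by
  have hsp := hI.1.isSpread_of_isMinGen hμ
  obtain ⟨hmax, hgap⟩ := mem_colonVars.1 ha
  set f := μ.orderEmbOfFin rfl with hf
  have hfs : IsSpreadSeq t f := hsp.isSpreadSeq rfl
  have him : Finset.univ.image f = μ := image_orderEmbOfFin μ rfl
  obtain ⟨b, hb, hab⟩ := lt_maxSupp.1 hmax
  have hne : (Finset.univ.filter fun p => a < f p).Nonempty := by
    obtain ⟨p, hp⟩ := exists_orderEmbOfFin_eq rfl hb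
    refine ⟨p, Finset.mem_filter.2 ⟨Finset.mem_univ _, ?_⟩⟩
    rw [hf, hp]
    exact lt_of_le_of_ne hab (by rintro rfl; exact haμ hb)
  set p := (Finset.univ.filter fun p => a < f p).min' hne with hp
  have hap : a < f p := by
    have := Finset.min'_mem _ hne
    rw [← hp] at this
    simpa using this
  have hlt : ∀ q < p, f q < a := by
    intro q hq
    by_contra h
    rcases (not_lt.1 h).eq_or_lt with h | h
    · exact haμ (h ▸ μ.orderEmbOfFin_mem rfl q)
    · exact hq.not_ge (Finset.min'_le _ _ (by simpa using h))
  have hstep : ∀ (h : Fin (d - 1)) (hh : (h : ℕ) + 1 = p),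
      (f ⟨h, by have := p.2; omega⟩ : ℕ) + t h ≤ a := by
    intro h hh
    have hh' : (h : ℕ) + 1 < μ.card := by rw [hh]; exact p.2
    refine hgap h hh' (hlt _ ?_)
    rw [Fin.lt_def]
    dsimp only
    omega
  have hmem := hI.update_mem hfs (by rw [him]; exact hμ.1) hap hlt hstep
  obtain ⟨ν, hν, hνI⟩ := exists_isMinGen_subset _ hmem
  have hu := hfs.update hap hlt hstep
  have hcard : (Finset.univ.image (Function.update f p a)).card = μ.card :=
    card_image_of_strictMono hu.strictMono
  refine ⟨ν, hνI, ?_, ?_⟩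
  · rcases hν.eq_or_ssubset with rfl | h
    · refine .inr ⟨hcard, ?_⟩
      rw [weight_image hu.strictMono]
      conv_rhs => rw [← him, weight_image hfs.strictMono]
      refine Finset.sum_lt_sum (fun q _ => ?_) ⟨p, Finset.mem_univ _, ?_⟩
      · by_cases hq : q = p
        · subst hq
          rw [Function.update_self]
          exact Nat.pow_le_pow_right (by norm_num) hap.le
        · rw [Function.update_of_ne hq]
      · rw [Function.update_self]
        exact Nat.pow_lt_pow_right (by norm_num) hap
    · exact .inl ((Finset.card_lt_card h).trans_eq hcard)
  · refine hν.trans ?_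
    rw [image_update hfs.strictMono, him]
    exact Finset.insert_subset_insert _ (Finset.erase_subset _ _)

/-- Lowering the entries of a spread sequence one after the other. -/
theorem IsSpreadStronglyStable.monomial_mem_of_le {I : Ideal (Ext K n)}
    (hI : IsSpreadStronglyStable t I) {s l : ℕ} (hsl : s ≤ l) {f : Fin s → Fin n}
    {g : Fin l → Fin n} (hf : IsSpreadSeq t f) (hg : IsSpreadSeq t g)
    (hle : ∀ p, g (Fin.castLE hsl p) ≤ f p) (hm : monomial K (Finset.univ.image f) ∈ I) :
    monomial K (Finset.univ.image fun p => g (Fin.castLE hsl p)) ∈ I := by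
  -- The first `q` entries come from `g`, the others from `f`. Working from left to right, the left
  -- gap at each new entry is already a gap of `g`.
  have key : ∀ q ≤ s, ∀ F : Fin s → Fin n,
      (F = fun p : Fin s => if (p : ℕ) < q then g (Fin.castLE hsl p) else f p) →
      IsSpreadSeq t F ∧ monomial K (Finset.univ.image F) ∈ I := by
    intro q
    induction q with
    | zero =>
      rintro - F rfl
      simpa using ⟨hf, hm⟩
    | succ q ih =>
      rintro hq F rfl
      obtain ⟨h1, h2⟩ := ih (by omega) _ rfl
      set F := fun p : Fin s => if (p : ℕ) < q then g (Fin.castLE hsl p) else f p with hF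
      set p : Fin s := ⟨q, hq⟩ with hp
      have hFp : F p = f p := by simp [hF, hp]
      have hup : (fun r : Fin s => if (r : ℕ) < q + 1 then g (Fin.castLE hsl r) else f r) =
          Function.update F p (g (Fin.castLE hsl p)) := by
        funext r
        by_cases hr : r = p
        · subst hr
          simp [hp]
        · have : (r : ℕ) ≠ q := fun h => hr (Fin.ext h)
          rw [Function.update_of_ne hr, hF]
          dsimp only
          congr 1
          apply propext
          omega
      rw [hup]
      rcases (hle p).eq_or_lt with heq | hlt
      · rw [heq, ← hFp, Function.update_eq_self]
        exact ⟨h1, h2⟩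
      · rw [← hFp] at hlt
        have c1 : ∀ r < p, F r < g (Fin.castLE hsl p) := by
          intro r hr
          have : (r : ℕ) < q := hr
          simp only [hF, if_pos this]
          exact hg.strictMono hr
        have c2 : ∀ (h : Fin (d - 1)) (hh : (h : ℕ) + 1 = p),
            (F ⟨h, by have := p.2; omega⟩ : ℕ) + t h ≤ g (Fin.castLE hsl p) := by
          intro h hh
          have hhq : (h : ℕ) + 1 = q := hh
          have hlt : (h : ℕ) < q := by omega
          have := hg.spread h (by omega)
          simp only [hF, if_pos hlt]
          rwa [show (⟨(h : ℕ) + 1, _⟩ : Fin l) = Fin.castLE hsl p from Fin.ext hhq] at this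
        exact ⟨h1.update hlt c1 c2, hI.update_mem h1 h2 hlt c1 c2⟩
  refine (key s le_rfl _ ?_).2
  funext p
  simp

/-- If no such `a` exists, the initial entries of `μ` are bounded by those of `ν`, one by one.
Lowering `ν` onto that initial segment puts it in `I`. A proper segment contradicts minimality of
`μ`; if it is all of `μ`, then `μ` and `ν` have equal degree and `μ` has weight at most that of `ν`,
contradicting the order. -/
theorem IsSpreadStronglyStable.exists_mem_colonVars {I : Ideal (Ext K n)}
    (hI : IsSpreadStronglyStable t I) {μ ν : Finset (Fin n)} (hμ : IsMinGen I μ)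
    (hν : IsMinGen I ν) (hνμ : Precedes ν μ) : ∃ a ∈ ν, a ∉ μ ∧ a ∈ colonVars t μ := by
  by_contra! hcon
  have hsp := hI.1.isSpread_of_isMinGen hμ
  have hspν := hI.1.isSpread_of_isMinGen hν
  have hsl : ν.card ≤ μ.card := by rcases hνμ with h | h <;> omega
  set f := ν.orderEmbOfFin rfl with hf
  set g := μ.orderEmbOfFin rfl with hg
  have hfs : IsSpreadSeq t f := hspν.isSpreadSeq rfl
  have hgs : IsSpreadSeq t g := hsp.isSpreadSeq rfl
  have hle : ∀ (p : ℕ) (hp : p < ν.card), g ⟨p, hp.trans_le hsl⟩ ≤ f ⟨p, hp⟩ := by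
    intro p
    induction p with
    | zero =>
      intro hp
      by_contra! hlt
      have h0 : ∀ q, f ⟨0, hp⟩ < g q := fun q =>
        hlt.trans_le (hgs.strictMono.monotone (Fin.mk_le_of_le_val (Nat.zero_le _)))
      refine hcon _ (ν.orderEmbOfFin_mem rfl ⟨0, hp⟩) ?_ ?_
      · intro hmem
        obtain ⟨q, hq⟩ := exists_orderEmbOfFin_eq rfl hmem
        exact (h0 q).ne' hq
      · refine mem_colonVars.2 ⟨lt_maxSupp.2 ⟨_, μ.orderEmbOfFin_mem rfl ⟨0, by omega⟩, hlt.le⟩, ?_⟩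
        intro h hh h1
        exact absurd h1 (not_lt.2 (h0 _).le)
    | succ p ih =>
      intro hp
      -- Otherwise `g p ≤ f p < f (p + 1) < g (p + 1)`. So `f (p + 1)` is not in `μ`, and it clears
      -- the gap after `g p` because it clears the one after `f p`; earlier gaps end by `g p`.
      by_contra! hlt
      have ih' := ih (by omega)
      have hpd : p < d - 1 := by have := hspν.2.1; omega
      have hspr := hfs.spread ⟨p, hpd⟩ hp
      have hinc : f ⟨p, by omega⟩ < f ⟨p + 1, hp⟩ := hfs.strictMono (by simp [Fin.lt_def])
      have hq : ∀ q, g q < g ⟨p + 1, hp.trans_le hsl⟩ → g q ≤ g ⟨p, by omega⟩ := by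
        intro q hq
        have h1 := hgs.strictMono.lt_iff_lt.1 hq
        refine hgs.strictMono.monotone ?_
        rw [Fin.lt_def] at h1
        rw [Fin.le_def]
        exact Nat.lt_succ_iff.1 h1
      refine hcon _ (ν.orderEmbOfFin_mem rfl ⟨p + 1, hp⟩) ?_ ?_
      · intro hmem
        obtain ⟨q, hq'⟩ := exists_orderEmbOfFin_eq rfl hmem
        have h1 : g q = f ⟨p + 1, hp⟩ := hq'
        have h2 := hq q (h1 ▸ hlt)
        rw [h1] at h2
        exact (ih'.trans_lt hinc).not_ge h2
      · refine mem_colonVars.2 ⟨lt_maxSupp.2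
          ⟨_, μ.orderEmbOfFin_mem rfl ⟨p + 1, by omega⟩, hlt.le⟩, ?_⟩
        intro h hh h1
        change (g _ : ℕ) < f _ at h1
        change (g _ : ℕ) + _ ≤ f _
        have h2 := hgs.strictMono.lt_iff_lt.1 (lt_trans (Fin.lt_def.2 h1) hlt)
        rw [Fin.lt_def] at h2
        dsimp only at h2
        rcases (Nat.lt_succ_iff.1 h2).eq_or_lt with h3 | h3
        · have h4 : h = ⟨p, hpd⟩ := Fin.ext h3
          subst h4
          exact (Nat.add_le_add_right (Fin.le_def.1 ih') _).trans hspr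
        · have h4 : g ⟨(h : ℕ) + 1, hh⟩ ≤ g ⟨p, by omega⟩ :=
            hgs.strictMono.monotone (by rw [Fin.le_def]; exact h3)
          exact (hgs.spread h hh).trans (Fin.le_def.1 (h4.trans (ih'.trans hinc.le)))
  have hmem := hI.monomial_mem_of_le hsl hfs hgs (fun p => hle p p.2)
    (by rw [hf, image_orderEmbOfFin]; exact hν.1)
  have hsub : (Finset.univ.image fun p => g (Fin.castLE hsl p)) ⊆ μ := by
    intro a ha
    obtain ⟨p, -, rfl⟩ := Finset.mem_image.1 ha
    exact μ.orderEmbOfFin_mem rfl _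
  have hmono : StrictMono fun p => g (Fin.castLE hsl p) := fun p q h => hgs.strictMono h
  rcases hsub.eq_or_ssubset with heq | hss
  · have hc : ν.card = μ.card := by
      rw [← card_image_of_strictMono hmono, heq]
    rcases hνμ with h | ⟨-, h⟩
    · omega
    · refine h.not_ge ?_
      conv_lhs => rw [← heq, weight_image hmono]
      conv_rhs => rw [← image_orderEmbOfFin ν rfl, weight_image hfs.strictMono]
      exact Finset.sum_le_sum fun p _ => Nat.pow_le_pow_right (by norm_num) (hle p p.2)
  · exact hμ.2 _ hss hmem

theorem IsSpreadStronglyStable.mul_monomial_mem_iff {I : Ideal (Ext K n)}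
    (hI : IsSpreadStronglyStable t I) {μ : Finset (Fin n)} (hμ : IsMinGen I μ) (x : Ext K n) :
    x * monomial K μ ∈ Ideal.span (monomial K '' {ν | IsMinGen I ν ∧ Precedes ν μ}) ↔
      x ∈ Ideal.span (e K '' (colonVars t μ : Set (Fin n))) := by
  rw [mul_monomial_mem_span_monomial, mem_span_e]
  refine forall_congr' fun ρ => imp_congr_right fun _ => ?_
  constructor
  · intro h
    by_cases hd : Disjoint ρ μ
    · obtain ⟨ν, ⟨hν, hνμ⟩, hsub⟩ := h hd
      obtain ⟨a, haν, haμ, ha⟩ := hI.exists_mem_colonVars hμ hν hνμ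
      exact ⟨a, ha, (Finset.mem_union.1 (hsub haν)).resolve_right haμ⟩
    · obtain ⟨a, haρ, haμ⟩ := Finset.not_disjoint_iff.1 hd
      exact ⟨a, (hI.1.isSpread_of_isMinGen hμ).subset_colonVars haμ, haρ⟩
  · rintro ⟨a, ha, haρ⟩ hd
    obtain ⟨ν, hν, hνμ, hsub⟩ := hI.exists_precedes hμ ha (Finset.disjoint_left.1 hd haρ)
    refine ⟨ν, ⟨hν, hνμ⟩, hsub.trans (Finset.insert_subset ?_ Finset.subset_union_right)⟩
    exact Finset.mem_union_left _ haρ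

/-- Below the maximum, the excluded indices form the open intervals from `i_h` to `i_h + t_h`,
disjoint by spreadness, with `t_h - 1` elements each, or none if `t_h = 0`. The last entry of `μ`
opens no interval. -/
theorem IsSpread.card_colonVars {μ : Finset (Fin n)} (hμ : IsSpread t μ) :
    (colonVars t μ).card = maxSupp μ -
      ∑ h ∈ Finset.univ.filter (fun h : Fin (d - 1) => (h : ℕ) + 1 < μ.card),
        (max (t h) 1 - 1) := by
  classical
  set f := μ.orderEmbOfFin rfl with hf
  have hfs : IsSpreadSeq t f := hμ.isSpreadSeq rfl
  -- The value `0` past the end is never used: all indices below are less than `μ.card`.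
  let v : ℕ → ℕ := fun p => if hp : p < μ.card then (f ⟨p, hp⟩ : ℕ) else 0
  have hv : ∀ p (hp : p < μ.card), (f ⟨p, hp⟩ : ℕ) = v p := fun p hp => by simp [v, hp]
  set H := Finset.univ.filter (fun h : Fin (d - 1) => (h : ℕ) + 1 < μ.card) with hH
  have hH' : ∀ h ∈ H, (h : ℕ) + 1 < μ.card := fun h hh => by simpa [hH] using hh
  have hstep : ∀ h ∈ H, v h + t h ≤ v (h + 1) := by
    intro h hh
    rw [← hv h (by have := hH' h hh; omega), ← hv _ (hH' h hh)]
    exact hfs.spread h (hH' h hh)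
  have hmono : ∀ p q, p ≤ q → q < μ.card → v p ≤ v q := by
    intro p q hpq hq
    rw [← hv p (by omega), ← hv q hq]
    exact Fin.le_def.1 (hfs.strictMono.monotone (Fin.mk_le_mk.2 hpq))
  have hvmax : ∀ p < μ.card, v p < maxSupp μ := by
    intro p hp
    rw [← hv p hp]
    exact lt_maxSupp.2 ⟨_, μ.orderEmbOfFin_mem rfl _, le_rfl⟩
  have hmaxn : maxSupp μ ≤ n := Finset.sup_le fun i _ => i.2
  have hmap : (colonVars t μ).map Fin.valEmbedding =
      -- `maxSupp` counts from `1` and indices from `0`, so this range includes the largest index of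
      -- `μ`.
      Finset.range (maxSupp μ) \ H.biUnion fun h => Finset.Ioo (v h) (v h + t h) := by
    ext a
    simp only [Finset.mem_map, Fin.valEmbedding_apply, Finset.mem_sdiff, Finset.mem_range,
      Finset.mem_biUnion, Finset.mem_Ioo, not_exists, not_and, not_lt]
    constructor
    · rintro ⟨a, ha, rfl⟩
      obtain ⟨h1, h2⟩ := mem_colonVars.1 ha
      refine ⟨h1, fun h hh hlt => ?_⟩
      have := h2 h (hH' h hh)
      rw [← hf, hv] at this
      exact this hlt
    · rintro ⟨h1, h2⟩
      refine ⟨⟨a, by omega⟩, mem_colonVars.2 ⟨h1, fun h hh => ?_⟩, rfl⟩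
      rw [← hf, hv]
      exact h2 h (by simpa [hH] using hh)
  have hdisj : (H : Set (Fin (d - 1))).PairwiseDisjoint fun h => Finset.Ioo (v h) (v h + t h) := by
    have key : ∀ h ∈ H, ∀ l ∈ H, h < l →
        Disjoint (Finset.Ioo (v h) (v h + t h)) (Finset.Ioo (v l) (v l + t l)) := by
      intro h hh l hl hlt
      have h1 := hstep h hh
      have h2 := hmono (h + 1) l hlt (by have := hH' l hl; omega)
      rw [Finset.disjoint_left]
      intro a ha hb
      rw [Finset.mem_Ioo] at ha hb
      omega
    intro h hh l hl hne
    rcases lt_or_gt_of_ne hne with hlt | hlt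
    · exact key h hh l hl hlt
    · exact (key l hl h hh hlt).symm
  rw [← Finset.card_map Fin.valEmbedding, hmap, Finset.card_sdiff_of_subset, Finset.card_range,
    Finset.card_biUnion hdisj]
  · congr 1
    refine Finset.sum_congr rfl fun h _ => ?_
    rw [Nat.card_Ioo]
    omega
  · intro a ha
    obtain ⟨h, hh, ha⟩ := Finset.mem_biUnion.1 ha
    rw [Finset.mem_Ioo] at ha
    rw [Finset.mem_range]
    have h1 := hstep h hh
    have h2 := hvmax _ (hH' h hh)
    omega

end VectorSpread

end

/-! ### Linear quotients of the ordered minimal generators, and the formula. -/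

noncomputable section

namespace VectorSpread

variable {K : Type*} [Field K] {d n : ℕ} {t : Fin (d - 1) → ℕ}

/-- The supports of the minimal monomial generators of `I`, as a type of their own so that it can
be ordered by degree and weight. -/
@[ext]
structure MinGen (I : Ideal (Ext K n)) : Type where
  supp : Finset (Fin n)
  isMinGen : IsMinGen I supp

variable {I : Ideal (Ext K n)}

instance : Fintype (MinGen I) :=
  have := Finite.of_injective (MinGen.supp (I := I)) fun _ _ => MinGen.ext
  Fintype.ofFinite _

instance : LinearOrder (MinGen I) :=
  LinearOrder.lift' (fun μ => toLex (μ.supp.card, weight μ.supp)) fun _ _ h =>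
    MinGen.ext (weight_injective (Prod.ext_iff.1 (toLex.injective h)).2)

theorem mem_minGens {j : ℕ} {μ : Finset (Fin n)} :
    μ ∈ minGens I j ↔ IsMinGen I μ ∧ μ.card = j := by
  classical
  rw [minGens, Finset.mem_filter]
  simp [IsMinGen]

theorem MinGen.lt_iff {ν μ : MinGen I} : ν < μ ↔ Precedes ν.supp μ.supp :=
  Prod.Lex.toLex_lt_toLex

theorem MinGen.monotone_card : Monotone fun μ : MinGen I => μ.supp.card := by
  intro ν μ h
  rcases h.eq_or_lt with rfl | h
  · exact le_rfl
  · rcases MinGen.lt_iff.1 h with h | h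
    · exact h.le
    · exact h.1.le

theorem IsSpreadStronglyStable.minGen_colon (hI : IsSpreadStronglyStable t I) (μ : MinGen I)
    (x : Ext K n) :
    x * monomial K μ.supp ∈
        Ideal.span ((fun ν : MinGen I => monomial K ν.supp) '' Set.Iio μ) ↔
      x ∈ Ideal.span (e K '' (colonVars t μ.supp : Set (Fin n))) := by
  rw [← hI.mul_monomial_mem_iff μ.isMinGen]
  have : (fun ν : MinGen I => monomial K ν.supp) '' Set.Iio μ =
      monomial K '' {ν | IsMinGen I ν ∧ Precedes ν μ.supp} := by
    ext y
    constructor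
    · rintro ⟨ν, hν, rfl⟩
      exact ⟨_, ⟨ν.isMinGen, MinGen.lt_iff.1 hν⟩, rfl⟩
    · rintro ⟨ν, ⟨h1, h2⟩, rfl⟩
      exact ⟨⟨ν, h1⟩, MinGen.lt_iff.2 h2, rfl⟩
  rw [this]

theorem IsSpreadIdeal.span_minGen (hI : IsSpreadIdeal t I) :
    Ideal.span (Set.range fun μ : MinGen I => monomial K μ.supp) = I := by
  conv_rhs => rw [← hI.span_isMinGen]
  congr 1
  ext y
  constructor
  · rintro ⟨μ, rfl⟩
    exact ⟨_, μ.isMinGen, rfl⟩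
  · rintro ⟨μ, hμ, rfl⟩
    exact ⟨⟨μ, hμ⟩, rfl⟩

theorem IsSpreadStronglyStable.nonempty_minGradedFreeRes (hI : IsSpreadStronglyStable t I) :
    Nonempty (MinGradedFreeRes I) := by
  have := VectorSpread.nonempty_minGradedFreeRes MinGen.monotone_card
    (fun μ : MinGen I => monomial_mem μ.supp) hI.minGen_colon
  rwa [hI.1.span_minGen] at this

theorem IsSpreadStronglyStable.betti_eq (hI : IsSpreadStronglyStable t I) (F : MinGradedFreeRes I)
    (i j : ℕ) : F.betti i ((i : ℤ) + (j : ℤ)) =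
      ∑ μ : MinGen I with μ.supp.card = j, (colonVars t μ.supp).card.multichoose i := by
  have h := VectorSpread.betti_eq MinGen.monotone_card
    (fun μ : MinGen I => monomial_mem μ.supp) hI.minGen_colon
  rw [hI.1.span_minGen] at h
  exact h F i j

end VectorSpread

end

/-- The ideal has a minimal graded free resolution, and in every one of them the number of copies of
`E(-(i+j))` in homological degree `i`, i.e. `β_{i,i+j}(I)`, is given by the formula.
The summand `max (t h) 1 - 1` is `max{t_h - 1, 0}`. No subtraction is truncated:
`m(u) - ∑ (max (t h) 1 - 1) ≥ j ≥ 1` for every `t`-spread monomial `u` of degree `j`. -/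
theorem corollary5p4 {K : Type*} [Field K] (n d : ℕ) (hn : 1 ≤ n) (hd : 2 ≤ d)
    (t : Fin (d - 1) → ℕ) (I : Ideal (VectorSpread.Ext K n))
    (hI : VectorSpread.IsSpreadStronglyStable t I) :
    Nonempty (VectorSpread.MinGradedFreeRes I) ∧
      ∀ (F : VectorSpread.MinGradedFreeRes I) (i j : ℕ),
        F.betti i ((i : ℤ) + (j : ℤ)) =
          ∑ μ ∈ VectorSpread.minGens I j,
            Nat.choose
              ((VectorSpread.maxSupp μ -
                  ∑ h ∈ Finset.univ.filter (fun h : Fin (d - 1) => (h : ℕ) + 1 < j),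
                    (max (t h) 1 - 1)) + i - 1)
              i := by
  refine ⟨hI.nonempty_minGradedFreeRes, fun F i j => ?_⟩
  rw [hI.betti_eq F i j]
  refine Finset.sum_bij (fun μ _ => μ.supp) ?_ ?_ ?_ ?_
  · intro μ hμ
    exact VectorSpread.mem_minGens.2 ⟨μ.isMinGen, (Finset.mem_filter.1 hμ).2⟩
  · intro μ _ ν _ h
    exact VectorSpread.MinGen.ext h
  · intro μ hμ
    obtain ⟨h1, h2⟩ := VectorSpread.mem_minGens.1 hμ
    exact ⟨⟨μ, h1⟩, Finset.mem_filter.2 ⟨Finset.mem_univ _, h2⟩, rfl⟩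
  · intro μ hμ
    obtain rfl : μ.supp.card = j := (Finset.mem_filter.1 hμ).2
    rw [(hI.1.isSpread_of_isMinGen μ.isMinGen).card_colonVars, Nat.multichoose_eq]
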